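/- Let $n\ge 2$, $k=\lfloor n/2\rfloor$, and let $\mathrm{Cl}(n)$ be the Clifford algebra of Euclidean $\mathbb R^n$, with vectors $\mathrm{Cl}^1(n)=\mathbb R^n$, bivectors $\mathrm{Cl}^2(n)$, and $x\wedge y=\tfrac12(xy-yx)$ for vectors $x,y$. A bivector $b$ acts on vectors by right contraction, $x\mapsto b\llcorner x$, a skew-symmetric map; its singular values and singular vectors are those of this map, and its eigenvalues and eigenvectors those of its complexification. *The algorithm.* A simple projection of a bivector $r$ is a pair $(s,w)$ with $s=\sigma\,(u\wedge w)$, where $\sigma$ is the top singular value of $r$ and $u,w$ are corresponding left and right unit singular vectors (if $r=0$ we only require $s=0$). Given $b\in\mathrm{Cl}^2(n)$ and $v_1,\dots,v_{k-1}\in\mathbb R^n$, the algorithm sets $r_1=b$ and, for $i=1,\dots,k-1$, computes $(b_i,w_i)=\mathrm{Proj}(r_i,v_i)$ and $r_{i+1}=r_i-b_i$; finally $b_k=r_k$. It returns $(b_1,\dots,b_k)$ and $(w_1,\dots,w_{k-1})$. The power-iteration subroutine $\mathrm{Proj}(r,v)$ iterates $x\mapsto y/\|y\|$, $y=r\llcorner(r\llcorner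 x)$ (with $0/0=0$), from $x_0=v$, and returns $((r\llcorner w)\wedge w,\;w)$ with $w=\lim_t x_{2t}$. The vectors $v_i$ are called admissible for $b$ if at every step with $r_i\neq 0$ the vector $v_i$ is not orthogonal to all top right singular vectors of $r_i$, where the residuals $r_i$ are those of the run with the power-iteration subroutine. *Theorem.* 1. Every bivector has a top singular value with corresponding unit singular vectors. For every subroutine whose outputs in the run on $b$ and $(v_i)$ are simple projections of the residuals (whichever singular vectors it chooses), the output of the algorithm is correct in the following sense. The $b_j$ are simple, commute with each other, are mutually orthogonal (the scalar part of $b_i^\dagger b_j$ vanishes for $i\ne j$), and $b=\sum_{j=1}^k b_j$. Moreover there are $\sigma_1\ge\dots\ge\sigma_k\ge0$ and an orthonormal system $x_1,\dots,x_k,y_1,\dots,y_k$ in $\mathbb R^n$ with $b\llcorner y_j=\sigma_jx_j$, $b\llcorner x_j=-\sigma_jy_j$, such that, with $\mu_j=i\sigma_j$ and $v_j^\pm=x_j\pm i\,y_j$ (eigenvectors of $b$ for $\pm\mu_j$), $$b_j=\sigma_j\,(x_j\wedge y_j)=\mu_j\,\frac{v_j^+\wedge v_j^-}{v_j^+\cdot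 v_j^-},\qquad v_j^+\cdot v_j^-\neq0,$$ the eigenvalues of $b$ with multiplicity are $\pm\mu_1,\dots,\pm\mu_k$ and $n-2k$ further zeros, and $w_j=y_j$ whenever $j<k$ and $b_j\neq0$. 2. If the $v_i$ are admissible for $b$, then in the algorithm with the power-iteration subroutine, at each step, the sequence $x_{2t}$ converges, $\|x_{t+1}+x_t\|\to0$, and the subroutine's output is a simple projection of $r_i$. Consequently the output of the algorithm is correct in the sense of 1. 3. If moreover the eigenvalues of $b$ with multiplicity are $\pm i\sigma_1,\dots,\pm i\sigma_k$ and $n-2k$ further zeros with $\sigma_1>\dots>\sigma_k\ge0$, then the map $(b,v_1,\dots,v_{k-1})\mapsto(b_1,\dots,b_k,w_1,\dots,w_{k-1})$ computed by the algorithm with the power-iteration subroutine is differentiable at $(b,v_1,\dots,v_{k-1})$. -/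

import Mathlib

open Filter Topology TensorProduct

noncomputable section

/-! ## The Clifford algebra `Cl(n)` of Euclidean space and its bivectors -/

/-- Euclidean space `ℝⁿ`, identified with the space of vectors `Cl¹(n)` through `CliffordAlgebra.ι`. -/
abbrev Vec (n : ℕ) : Type := EuclideanSpace ℝ (Fin n)

/-- The quadratic form `x ↦ ⟪x, x⟫` on `ℝⁿ`. -/
def euclQ (n : ℕ) : QuadraticForm ℝ (Vec n) :=
  LinearMap.BilinMap.toQuadraticMap (innerₗ (Vec n))

/-- The Clifford algebra `Cl(n) = Cl(n,0)`. -/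
abbrev Cl (n : ℕ) : Type := CliffordAlgebra (euclQ n)

/-- The embedding of vectors into `Cl(n)`. -/
abbrev vec {n : ℕ} (x : Vec n) : Cl n := CliffordAlgebra.ι (euclQ n) x

/-- The `i`-th vector of the standard orthonormal basis. -/
abbrev stdVec {n : ℕ} (i : Fin n) : Vec n := EuclideanSpace.single i 1

/-- The outer product of two vectors of a (real or complexified) Clifford algebra,
`x ∧ y = (x y - y x) / 2`. It is only ever applied to vectors. -/
def wedge {A : Type*} [Ring A] [Algebra ℝ A] (x y : A) : A :=
  (1 / 2 : ℝ) • (x * y - y * x)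

/-- The space of bivectors `Cl²(n)`. -/
def Cl2 (n : ℕ) : Submodule ℝ (Cl n) :=
  Submodule.span ℝ {b | ∃ x y : Vec n, b = wedge (vec x) (vec y)}

/-- The bivector `∑_{i < j} c i j • (e i ∧ e j)`; the entries of `c` with `i ≥ j` are not used. -/
def bivec {n : ℕ} (c : Fin n → Fin n → ℝ) : Cl n :=
  ∑ i, ∑ j ∈ Finset.Ioi i, c i j • wedge (vec (stdVec i)) (vec (stdVec j))

/-- The grade-0 part of a multivector. -/
def scalarPart {n : ℕ} (x : Cl n) : ℝ :=
  ExteriorAlgebra.algebraMapInv (CliffordAlgebra.equivExterior (euclQ n) x)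

/-- The grade-1 part of a multivector, as a vector of `ℝⁿ`. -/
def vecPart (n : ℕ) : Cl n →ₗ[ℝ] Vec n :=
  ExteriorAlgebra.ιInv ∘ₗ (CliffordAlgebra.equivExterior (euclQ n)).toLinearMap

/-- The linear map `x ↦ b ⌞ x` (right contraction of a bivector `b` by a vector `x`). The
contraction of a bivector by a vector is a vector, so taking the grade-1 part only changes
the type in which it lives. -/
def contr {n : ℕ} (b : Cl n) : Vec n →ₗ[ℝ] Vec n :=
  vecPart n ∘ₗ CliffordAlgebra.contractRight b ∘ₗ innerₗ (Vec n)

/-- The skew-symmetric matrix of a bivector, `B i j = ⟪e i, b ⌞ e j⟫`. -/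
def skewMat {n : ℕ} (b : Cl n) : Matrix (Fin n) (Fin n) ℝ :=
  Matrix.of fun i j => contr b (stdVec j) i

/-! ## Simple projections and the two algorithms -/

/-- `σ` is the top singular value of (the linear map of) `b`, and `u`, `v` are corresponding left
and right unit singular vectors. -/
structure IsTopSingular {n : ℕ} (b : Cl n) (σ : ℝ) (u v : Vec n) : Prop where
  norm_left : ‖u‖ = 1
  norm_right : ‖v‖ = 1
  map_right : contr b v = σ • u
  map_left : LinearMap.adjoint (contr b) u = σ • v
  top : ∀ x : Vec n, ‖contr b x‖ ≤ σ * ‖x‖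

/-- `(s, v)` is an exact output of the simple projection of `b`: `v` is a right singular vector
for the top singular value `σ` and `s = σ (u ∧ v)`. The simple projection of `b = 0` is `0`; no
singular vector has to be reported then. -/
def IsSimpleProj {n : ℕ} (b s : Cl n) (v : Vec n) : Prop :=
  (b = 0 ∧ s = 0) ∨
    ∃ (σ : ℝ) (u : Vec n), IsTopSingular b σ u v ∧ s = σ • wedge (vec u) (vec v)

/-- The decomposition algorithm, with subroutine `proj`, for `m` input vectors: extract
`proj b v₁`, subtract it, continue with the residual and the remaining vectors, and finally append
the last residual. It returns the list of bivectors and the list of vectors. -/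
def invDecomp {n : ℕ} (proj : Cl n → Vec n → Cl n × Vec n) :
    (m : ℕ) → Cl n → (Fin m → Vec n) → (Fin (m + 1) → Cl n) × (Fin m → Vec n)
  | 0, b, _ => (fun _ => b, Fin.elim0)
  | m + 1, b, v =>
    ((Fin.cons (proj b (v 0)).1
        (invDecomp proj m (b - (proj b (v 0)).1) (Fin.tail v)).1 : Fin (m + 2) → Cl n),
      (Fin.cons (proj b (v 0)).2
        (invDecomp proj m (b - (proj b (v 0)).1) (Fin.tail v)).2 : Fin (m + 1) → Vec n))

/-- The predicate `P` holds for each of the `m` pairs (current residual, current input vector) on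
which the decomposition algorithm calls its subroutine. -/
def AlongRun {n : ℕ} (proj : Cl n → Vec n → Cl n × Vec n) (P : Cl n → Vec n → Prop) :
    (m : ℕ) → Cl n → (Fin m → Vec n) → Prop
  | 0, _, _ => True
  | m + 1, b, v => P b (v 0) ∧ AlongRun proj P m (b - (proj b (v 0)).1) (Fin.tail v)

/-- One step of the power iteration, `x ↦ y / ‖y‖` with `y = b ⌞ (b ⌞ x)` (and `0` if `y = 0`). -/
def powerStep {n : ℕ} (b : Cl n) (x : Vec n) : Vec n :=
  ‖contr b (contr b x)‖⁻¹ • contr b (contr b x)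

/-- The simple projection computed by the power iteration run to convergence. The iterates
alternate in sign in the limit, so the limit `w` of the even ones is taken; the output is
`((b ⌞ w) ∧ w, w)`, whose first component does not depend on the sign of `w`. -/
def powerProj {n : ℕ} (b : Cl n) (x : Vec n) : Cl n × Vec n :=
  let w : Vec n := limUnder atTop fun t : ℕ => (powerStep b)^[2 * t] x
  (wedge (vec (contr b w)) (vec w), w)

/-- The power iteration for `b` started at `x` converges up to the alternating sign, and its
stopping quantity `‖v + v_prev‖` tends to `0`. -/
def PowerConverges {n : ℕ} (b : Cl n) (x : Vec n) : Prop :=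
  Tendsto (fun t : ℕ => (powerStep b)^[2 * t] x) atTop (𝓝 (powerProj b x).2) ∧
    Tendsto (fun t : ℕ => ‖(powerStep b)^[t + 1] x + (powerStep b)^[t] x‖) atTop (𝓝 0)

/-- Unless `b = 0`, the vector `x` has a nonzero component along some top singular vector of `b`,
that is, in the direction of the dominant simple component. -/
def GoodStart {n : ℕ} (b : Cl n) (x : Vec n) : Prop :=
  b ≠ 0 → ∃ (σ : ℝ) (u y : Vec n), IsTopSingular b σ u y ∧ inner ℝ y x ≠ 0

/-- The singular-value pairs of `b` are pairwise distinct: the eigenvalues of `b` are `± i σ_j` for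
`σ_0 > ⋯ > σ_m ≥ 0` (and a further `0` if `n > 2 (m + 1)`). -/
def Nondegenerate {n : ℕ} (m : ℕ) (b : Cl n) : Prop :=
  ∃ σ : Fin (m + 1) → ℝ, StrictAnti σ ∧ (∀ j, 0 ≤ σ j) ∧
    (skewMat b).charpoly = Polynomial.X ^ (n - 2 * (m + 1)) *
      ∏ j, (Polynomial.X ^ 2 + Polynomial.C (σ j ^ 2))

/-! ## The invariant decomposition and its spectral form -/

/-- `b` is the sum of the mutually commuting, mutually orthogonal simple bivectors `d j`. -/
structure IsInvariantDecomp {n k : ℕ} (b : Cl n) (d : Fin k → Cl n) : Prop where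
  sum_eq : ∑ j, d j = b
  simple : ∀ j, ∃ x y : Vec n, d j = wedge (vec x) (vec y)
  comm : ∀ i j, d i * d j = d j * d i
  orthogonal : ∀ i j, i ≠ j → scalarPart (CliffordAlgebra.reverse (d i) * d j) = 0

/-- The complex vector `x + i y`. -/
def cvec {n : ℕ} (x y : Vec n) : Fin n → ℂ := fun i => (x i : ℂ) + Complex.I * (y i : ℂ)

/-- The embedding of complex vectors into the complexified Clifford algebra. -/
def cι {n : ℕ} (z : Fin n → ℂ) : ℂ ⊗[ℝ] Cl n := ∑ i, z i ⊗ₜ[ℝ] vec (stdVec i)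

/-- The complex matrix of `x ↦ b ⌞ x`. -/
def cMat {n : ℕ} (b : Cl n) : Matrix (Fin n) (Fin n) ℂ := (skewMat b).map Complex.ofReal

/-- `zp` and `zm` are eigenvectors of `b` for the eigenvalues `μ` and `-μ`, with `zp · zm ≠ 0` for
the complex-bilinear dot product, and `d = μ (zp ∧ zm) / (zp · zm)`. -/
structure IsSpectralTerm {n : ℕ} (b d : Cl n) (μ : ℂ) (zp zm : Fin n → ℂ) : Prop where
  ne_zero_plus : zp ≠ 0
  ne_zero_minus : zm ≠ 0
  eigen_plus : (cMat b).mulVec zp = μ • zp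
  eigen_minus : (cMat b).mulVec zm = (-μ) • zm
  dot_ne_zero : dotProduct zp zm ≠ 0
  formula : (1 : ℂ) ⊗ₜ[ℝ] d = (μ / dotProduct zp zm) • wedge (cι zp) (cι zm)

/-- The output `(d, w)` is correct for the input `b`: `d` is an invariant decomposition of `b`, and
there are `σ_0 ≥ ⋯ ≥ σ_m ≥ 0` and an orthonormal system of vectors `x_j`, `y_j` such that
`x_j`, `y_j` are left and right singular vectors of `b` for `σ_j`, `d_j = σ_j (x_j ∧ y_j)`,
`d_j` is the spectral term of the eigenvalue `μ_j = i σ_j` and of the partner eigenvectors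
`x_j ± i y_j`, the spectrum of `b` with multiplicities is `± μ_0, …, ± μ_m` together with
`n - 2 (m + 1)` zeros, and `w_j = y_j` whenever `d_j ≠ 0`. -/
def IsCorrectOutput {n m : ℕ} (b : Cl n) (d : Fin (m + 1) → Cl n) (w : Fin m → Vec n) : Prop :=
  IsInvariantDecomp b d ∧
    ∃ (σ : Fin (m + 1) → ℝ) (x y : Fin (m + 1) → Vec n),
      Antitone σ ∧ (∀ j, 0 ≤ σ j) ∧ Orthonormal ℝ (Sum.elim x y) ∧
      (∀ j, contr b (y j) = σ j • x j ∧ contr b (x j) = -(σ j • y j)) ∧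
      (∀ j, d j = σ j • wedge (vec (x j)) (vec (y j))) ∧
      (∀ j, IsSpectralTerm b (d j) (Complex.I * (σ j : ℂ)) (cvec (x j) (y j))
        (cvec (x j) (-(y j)))) ∧
      (cMat b).charpoly = Polynomial.X ^ (n - 2 * (m + 1)) *
        ∏ j, ((Polynomial.X - Polynomial.C (Complex.I * (σ j : ℂ))) *
          (Polynomial.X + Polynomial.C (Complex.I * (σ j : ℂ)))) ∧
      (∀ i : Fin m, d i.castSucc ≠ 0 → w i = y i.castSucc)

end

open Filter Topology TensorProduct

/-! ## Bivectors and the skew-symmetric maps they define -/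

section Bivectors

variable {n : ℕ}

/-! Contraction turns bivectors faithfully into skew maps `A` (`eq_sum_skewMat`), so the theorem is
about skew maps. If the unit vector `w` maximizes `‖A x‖` on the sphere, with maximum `σ`, then `A²
w = -σ² w` (`contr_contr_of_norm_eq`). For `σ > 0`, `w` and `u = A w / σ` therefore span an
invariant plane on which `A` is `σ (u ∧ w)`. Subtracting this term leaves a skew map that kills the
plane, has range in its orthogonal complement and has no larger norm. Induction on a subspace `W`
containing the range, whose dimension falls by 2 at each step, yields the orthonormal system
(`exists_isSingularSystem`); a last residual on dimension 2 or 3 is automatically simple. Blocks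
with product zero have essentially multiplicative characteristic polynomials, which gives the
spectrum.

For the power iteration, `S = A² / (-σ²)` is symmetric with spectrum in `[0, 1]`, so `S ^ t x` tends
to the projection `L` of `x` onto the top singular space. Admissibility says `L ≠ 0`, and the
iterates are `± S ^ t x / ‖S ^ t x‖` (`exists_power_limit`).

For differentiability, let `iσ` be a simple root of the characteristic polynomial `p`. Then `adj(iσ
- A) / p'(iσ)` is the spectral projection of `iσ`, and twice its real part sends `x` to `L`
(`topProj`). The root depends differentiably on the matrix by the inverse function theorem
(`differentiableAt_simple_root`), hence so does `L / ‖L‖`. Residuals of nondegenerate bivectors are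
nondegenerate (`Nondegenerate.residual`), so the argument repeats along the run. -/

theorem wedge_comm_neg {A : Type*} [Ring A] [Algebra ℝ A] (x y : A) : wedge x y = -wedge y x := by
  unfold wedge; rw [← smul_neg, neg_sub]

theorem wedge_add_add_neg {A : Type*} [Ring A] [Algebra ℝ A] (a c : A) :
    wedge (a + c) (a + -c) = (-2 : ℝ) • wedge a c := by
  unfold wedge
  simp only [mul_add, add_mul, mul_neg, neg_mul]
  module

theorem wedge_vec_mem_Cl2 (x y : Vec n) : wedge (vec x) (vec y) ∈ Cl2 n :=
  Submodule.subset_span ⟨x, y, rfl⟩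

theorem wedge_vec_smul_left (r : ℝ) (x y : Vec n) :
    wedge (vec (r • x)) (vec y) = r • wedge (vec x) (vec y) := by
  have h : vec (r • x) = r • vec x := map_smul _ _ _
  rw [wedge, wedge, h, smul_mul_assoc, mul_smul_comm, ← smul_sub, smul_comm]

theorem contractRight_wedge (d : Module.Dual ℝ (Vec n)) (x y : Vec n) :
    CliffordAlgebra.contractRight (wedge (vec x) (vec y)) d = vec (d y • x - d x • y) := by
  simp only [wedge, map_smul, map_sub, LinearMap.smul_apply, LinearMap.sub_apply,
    CliffordAlgebra.contractRight_mul_ι, CliffordAlgebra.contractRight_ι,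
    ← Algebra.smul_def]
  module

theorem vecPart_vec (x : Vec n) : vecPart n (vec x) = x := by
  simp only [vecPart, LinearMap.comp_apply, LinearEquiv.coe_coe, CliffordAlgebra.equivExterior,
    CliffordAlgebra.changeFormEquiv_apply, CliffordAlgebra.changeForm_ι]
  exact ExteriorAlgebra.ι_leftInverse x

theorem contr_wedge (x y z : Vec n) :
    contr (wedge (vec x) (vec y)) z = inner ℝ y z • x - inner ℝ x z • y := by
  simp only [contr, LinearMap.comp_apply]
  rw [contractRight_wedge, vecPart_vec]
  simp [innerₗ_apply_apply, real_inner_comm]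

theorem contr_add (a b : Cl n) : contr (a + b) = contr a + contr b := by
  ext1 x; simp [contr]

theorem contr_smul (r : ℝ) (b : Cl n) : contr (r • b) = r • contr b := by
  ext1 x; simp [contr]

/-- The contraction `b ↦ (x ↦ b ⌞ x)` as a linear map. -/
noncomputable def contrₗ (n : ℕ) : Cl n →ₗ[ℝ] Vec n →ₗ[ℝ] Vec n where
  toFun := contr
  map_add' := contr_add
  map_smul' := contr_smul

theorem contr_sub (a b : Cl n) : contr (a - b) = contr a - contr b := map_sub (contrₗ n) a b

theorem contr_zero : contr (0 : Cl n) = 0 := map_zero (contrₗ n)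

theorem contr_sum {ι : Type*} (s : Finset ι) (f : ι → Cl n) :
    contr (∑ i ∈ s, f i) = ∑ i ∈ s, contr (f i) := map_sum (contrₗ n) f s

theorem inner_contr {b : Cl n} (hb : b ∈ Cl2 n) (x y : Vec n) :
    inner ℝ (contr b x) y = -inner ℝ x (contr b y) := by
  induction hb using Submodule.span_induction with
  | mem b h =>
    obtain ⟨u, v, rfl⟩ := h
    simp only [contr_wedge, inner_sub_left, inner_sub_right,
      real_inner_smul_right, real_inner_comm]
    ring
  | zero => simp [contr_zero]
  | add a c _ _ ha hc =>
    simp only [contr_add, LinearMap.add_apply, inner_add_left, inner_add_right, ha, hc]; ring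
  | smul r a _ ha =>
    simp only [contr_smul, LinearMap.smul_apply, real_inner_smul_left, real_inner_smul_right, ha]
    ring

theorem inner_contr_self {b : Cl n} (hb : b ∈ Cl2 n) (x : Vec n) :
    inner ℝ x (contr b x) = 0 := by
  have := inner_contr hb x x
  rw [real_inner_comm] at this
  linarith

theorem adjoint_contr {b : Cl n} (hb : b ∈ Cl2 n) : LinearMap.adjoint (contr b) = -contr b := by
  symm
  rw [LinearMap.eq_adjoint_iff]
  intro x y
  simp [inner_contr hb]

theorem eq_sum_single (x : Vec n) : x = ∑ i, x i • stdVec i := by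
  ext j
  simp [Finset.sum_apply, Pi.single_apply]

theorem vec_eq_sum (x : Vec n) : vec x = ∑ i, x i • vec (stdVec i) := by
  conv_lhs => rw [eq_sum_single x]
  simp [vec]

theorem wedge_vec_eq_sum (x y : Vec n) :
    wedge (vec x) (vec y) = ∑ i, ∑ j, (x i * y j) • wedge (vec (stdVec i)) (vec (stdVec j)) := by
  have h : ∀ x y : Vec n, vec x * vec y
      = ∑ i, ∑ j, (x i * y j) • (vec (stdVec i) * vec (stdVec j)) := by
    intro x y
    rw [vec_eq_sum x, vec_eq_sum y, Finset.sum_mul_sum]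
    simp only [smul_mul_smul_comm]
  unfold wedge
  rw [h x y, h y x, Finset.sum_comm (f := fun i j => (y i * x j) • _), ← Finset.sum_sub_distrib,
    Finset.smul_sum]
  refine Finset.sum_congr rfl fun i _ => ?_
  rw [← Finset.sum_sub_distrib, Finset.smul_sum]
  refine Finset.sum_congr rfl fun j _ => ?_
  rw [mul_comm (y j), ← smul_sub, smul_comm]

theorem skewMat_wedge (x y : Vec n) (i j : Fin n) :
    skewMat (wedge (vec x) (vec y)) i j = x i * y j - x j * y i := by
  simp only [skewMat, Matrix.of_apply, contr_wedge]
  simp [EuclideanSpace.inner_single_right, mul_comm]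

theorem skewMat_sub (a b : Cl n) : skewMat (a - b) = skewMat a - skewMat b := by
  ext i j; simp [skewMat, contr_sub]

theorem skewMat_add (a b : Cl n) : skewMat (a + b) = skewMat a + skewMat b := by
  ext i j; simp [skewMat, contr_add]

theorem skewMat_smul (r : ℝ) (b : Cl n) : skewMat (r • b) = r • skewMat b := by
  ext i j; simp [skewMat, contr_smul]

theorem skewMat_zero : skewMat (0 : Cl n) = 0 := by
  ext i j; simp [skewMat, contr_zero]

/-- Both sides are linear in `b`. On a generator the full double sum counts `x ∧ y` and `-(y ∧ x)`,
hence the factor one half. -/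
theorem eq_sum_skewMat {b : Cl n} (hb : b ∈ Cl2 n) :
    b = (1 / 2 : ℝ) • ∑ i, ∑ j, skewMat b i j • wedge (vec (stdVec i)) (vec (stdVec j)) := by
  induction hb using Submodule.span_induction with
  | mem b h =>
    obtain ⟨x, y, rfl⟩ := h
    simp only [skewMat_wedge, sub_smul, Finset.sum_sub_distrib]
    rw [← wedge_vec_eq_sum x y]
    have : ∑ i, ∑ j, (x j * y i) • wedge (vec (stdVec i)) (vec (stdVec j))
        = wedge (vec y) (vec x) := by
      rw [wedge_vec_eq_sum y x]; simp only [mul_comm]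
    rw [this, wedge_comm_neg (vec y)]
    module
  | zero => simp [skewMat_zero]
  | add a c _ _ ha hc =>
    conv_lhs => rw [ha, hc]
    simp only [skewMat_add, Matrix.add_apply, add_smul, Finset.sum_add_distrib, smul_add]
  | smul r a _ ha =>
    conv_lhs => rw [ha]
    simp only [skewMat_smul, Matrix.smul_apply, smul_eq_mul, mul_smul, Finset.smul_sum,
      smul_comm r]

theorem eq_zero_of_contr_eq_zero {b : Cl n} (hb : b ∈ Cl2 n) (h : contr b = 0) : b = 0 := by
  rw [eq_sum_skewMat hb]
  simp [skewMat, h]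

theorem skewMat_mulVec (b : Cl n) (x : Vec n) (i : Fin n) :
    (skewMat b).mulVec x i = contr b x i := by
  conv_rhs => rw [eq_sum_single x]
  simp [Matrix.mulVec, dotProduct, skewMat, mul_comm]

theorem skewMat_mul (a b : Cl n) (i j : Fin n) :
    (skewMat a * skewMat b) i j = contr a (contr b (stdVec j)) i := by
  rw [← skewMat_mulVec]
  simp [Matrix.mul_apply, Matrix.mulVec, dotProduct, skewMat]

theorem bivec_mem_Cl2 (c : Fin n → Fin n → ℝ) : bivec c ∈ Cl2 n :=
  Submodule.sum_mem _ fun _ _ => Submodule.sum_mem _ fun _ _ =>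
    Submodule.smul_mem _ _ (wedge_vec_mem_Cl2 _ _)

/-! ### Products of orthogonal vectors -/

theorem isOrtho_euclQ {x y : Vec n} (h : inner ℝ x y = 0) : (euclQ n).IsOrtho x y := by
  simp [QuadraticMap.isOrtho_def, euclQ, inner_add_right, h, real_inner_comm]

theorem vec_mul_vec_of_ortho {x y : Vec n} (h : inner ℝ x y = 0) :
    vec x * vec y = -(vec y * vec x) :=
  CliffordAlgebra.ι_mul_ι_comm_of_isOrtho (isOrtho_euclQ h)

theorem wedge_vec_of_ortho {x y : Vec n} (h : inner ℝ x y = 0) :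
    wedge (vec x) (vec y) = vec x * vec y := by
  unfold wedge
  rw [vec_mul_vec_of_ortho (x := y) (y := x) (by rwa [real_inner_comm])]
  module

theorem wedge_comm_of_ortho {x y z w : Vec n} (hxy : inner ℝ x y = 0) (hzw : inner ℝ z w = 0)
    (hxz : inner ℝ x z = 0) (hxw : inner ℝ x w = 0) (hyz : inner ℝ y z = 0)
    (hyw : inner ℝ y w = 0) :
    wedge (vec x) (vec y) * wedge (vec z) (vec w) =
      wedge (vec z) (vec w) * wedge (vec x) (vec y) := by
  rw [wedge_vec_of_ortho hxy, wedge_vec_of_ortho hzw]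
  calc vec x * vec y * (vec z * vec w) = vec x * (vec y * vec z) * vec w := by noncomm_ring
    _ = -((vec x * vec z) * (vec y * vec w)) := by rw [vec_mul_vec_of_ortho hyz]; noncomm_ring
    _ = -(vec z * (vec x * vec w) * vec y) := by
      rw [vec_mul_vec_of_ortho hxz, vec_mul_vec_of_ortho hyw]; noncomm_ring
    _ = _ := by rw [vec_mul_vec_of_ortho hxw]; noncomm_ring

/-- In the exterior algebra, `x t` becomes an exterior product with `x`, which has no scalar part,
minus a contraction of `t` by a functional proportional to `⟪x, ·⟫`. Quantifying over all
functionals that vanish on the complement of `x` makes the constant irrelevant. -/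
theorem scalarPart_vec_mul {x : Vec n} {t : Cl n}
    (h : ∀ d : Module.Dual ℝ (Vec n), (∀ z, inner ℝ x z = 0 → d z = 0) →
      CliffordAlgebra.contractLeft d t = 0) :
    scalarPart (vec x * t) = 0 := by
  simp only [scalarPart, CliffordAlgebra.equivExterior, CliffordAlgebra.changeFormEquiv_apply,
    vec]
  rw [CliffordAlgebra.changeForm_ι_mul, ← CliffordAlgebra.changeForm_contractLeft, h, map_zero,
    sub_zero, map_mul]
  · have : ExteriorAlgebra.algebraMapInv (CliffordAlgebra.ι (0 : QuadraticForm ℝ (Vec n)) x)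
        = (0 : ℝ) := by
      change ExteriorAlgebra.algebraMapInv (ExteriorAlgebra.ι ℝ x) = 0
      simp [ExteriorAlgebra.algebraMapInv]
    rw [this, zero_mul]
  · intro z hz
    simp [QuadraticMap.associated_apply, euclQ, inner_add_right, hz,
      real_inner_comm]

theorem scalarPart_reverse_mul {x y z w : Vec n} (hxy : inner ℝ x y = 0) (hzw : inner ℝ z w = 0)
    (hyz : inner ℝ y z = 0) (hyw : inner ℝ y w = 0) :
    scalarPart (CliffordAlgebra.reverse (wedge (vec x) (vec y)) * wedge (vec z) (vec w)) = 0 := by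
  rw [wedge_vec_of_ortho hxy, wedge_vec_of_ortho hzw]
  simp only [vec, CliffordAlgebra.reverse.map_mul, CliffordAlgebra.reverse_ι, mul_assoc]
  -- The product is now `y x z w`, with `y` orthogonal to the other three factors.
  refine scalarPart_vec_mul fun d hd => ?_
  simp only [CliffordAlgebra.contractLeft_ι_mul, CliffordAlgebra.contractLeft_ι]
  rw [hd x (by rwa [real_inner_comm]), hd z hyz, hd w hyw]
  simp

theorem scalarPart_smul (r : ℝ) (x : Cl n) : scalarPart (r • x) = r * scalarPart x := by
  simp [scalarPart]

/-! ### Complexification -/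

theorem cι_cvec (x y : Vec n) :
    cι (cvec x y) = (1 : ℂ) ⊗ₜ[ℝ] vec x + Complex.I ⊗ₜ[ℝ] vec y := by
  rw [vec_eq_sum x, vec_eq_sum y, TensorProduct.tmul_sum, TensorProduct.tmul_sum,
    ← Finset.sum_add_distrib]
  refine Finset.sum_congr rfl fun i _ => ?_
  rw [← TensorProduct.smul_tmul, ← TensorProduct.smul_tmul, ← TensorProduct.add_tmul]
  congr 1
  simp [cvec, mul_comm]

theorem cMat_mulVec_cvec (b : Cl n) (x y : Vec n) :
    (cMat b).mulVec (cvec x y) = cvec (contr b x) (contr b y) := by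
  ext i
  simp only [cvec, ← skewMat_mulVec, Matrix.mulVec, dotProduct, cMat, Matrix.map_apply]
  push_cast
  rw [Finset.mul_sum, ← Finset.sum_add_distrib]
  refine Finset.sum_congr rfl fun j _ => ?_
  ring

theorem dotProduct_cvec (x y z w : Vec n) : dotProduct (cvec x y) (cvec z w) =
    ((inner ℝ x z - inner ℝ y w : ℝ) : ℂ) + Complex.I * ((inner ℝ x w + inner ℝ y z : ℝ) : ℂ) := by
  simp only [dotProduct, cvec, PiLp.inner_apply, RCLike.inner_apply, conj_trivial]
  push_cast
  simp only [← Finset.sum_sub_distrib, ← Finset.sum_add_distrib, Finset.mul_sum]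
  refine Finset.sum_congr rfl fun j _ => ?_
  linear_combination (y j * w j : ℂ) * Complex.I_sq

theorem isSpectralTerm_of_singular {b : Cl n} {σ : ℝ} {x y : Vec n} (hx : ‖x‖ = 1) (hy : ‖y‖ = 1)
    (hby : contr b y = σ • x) (hbx : contr b x = -(σ • y)) :
    IsSpectralTerm b (σ • wedge (vec x) (vec y)) (Complex.I * (σ : ℂ)) (cvec x y)
      (cvec x (-y)) := by
  have hdot : dotProduct (cvec x y) (cvec x (-y)) = 2 := by
    rw [dotProduct_cvec]
    simp only [inner_neg_right, real_inner_self_eq_norm_sq, hx, hy, real_inner_comm]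
    push_cast; ring
  have hne : dotProduct (cvec x y) (cvec x (-y)) ≠ 0 := by rw [hdot]; norm_num
  refine ⟨?_, ?_, ?_, ?_, hne, ?_⟩
  · rintro h; simp [h] at hne
  · rintro h; simp [h] at hne
  · rw [cMat_mulVec_cvec, hby, hbx]
    ext i
    simp only [cvec, PiLp.neg_apply, PiLp.smul_apply, smul_eq_mul, Pi.smul_apply]
    push_cast
    linear_combination (-(σ * y i) : ℂ) * Complex.I_sq
  · rw [cMat_mulVec_cvec, map_neg, hby, hbx]
    ext i
    simp only [cvec, PiLp.neg_apply, PiLp.smul_apply, smul_eq_mul, Pi.smul_apply]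
    push_cast
    linear_combination (-(σ * y i) : ℂ) * Complex.I_sq
  · have hneg : vec (-y) = -vec y := map_neg _ _
    rw [hdot, cι_cvec, cι_cvec, hneg, TensorProduct.tmul_neg]
    -- `(x + iy) ∧ (x - iy) = -2i (x ∧ y)`; with dot product 2 the coefficient becomes `(iσ /
    -- 2)(-2i) = σ`.
    have : wedge ((1 : ℂ) ⊗ₜ[ℝ] vec x + Complex.I ⊗ₜ[ℝ] vec y)
        ((1 : ℂ) ⊗ₜ[ℝ] vec x + -(Complex.I ⊗ₜ[ℝ] vec y))
        = (-2 * Complex.I) ⊗ₜ[ℝ] wedge (vec x) (vec y) := by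
      have h2 : wedge ((1 : ℂ) ⊗ₜ[ℝ] vec x) (Complex.I ⊗ₜ[ℝ] vec y)
          = Complex.I ⊗ₜ[ℝ] wedge (vec x) (vec y) := by
        simp only [wedge, Algebra.TensorProduct.tmul_mul_tmul, one_mul, mul_one,
          TensorProduct.tmul_smul, TensorProduct.tmul_sub]
      rw [wedge_add_add_neg, h2, TensorProduct.smul_tmul']
      simp
    rw [this, TensorProduct.smul_tmul', TensorProduct.tmul_smul, TensorProduct.smul_tmul']
    congr 1
    simp only [smul_eq_mul, Complex.real_smul]
    linear_combination (σ : ℂ) * Complex.I_sq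

/-! ### Characteristic polynomials -/

open Polynomial in
-- `M N = 0` gives `(X - M)(X - N) = X (X - (M + N))`; take determinants.
theorem charpoly_mul_charpoly_of_mul_eq_zero {ι R : Type*} [Fintype ι] [DecidableEq ι]
    [CommRing R] {M N : Matrix ι ι R} (h : M * N = 0) :
    M.charpoly * N.charpoly = X ^ Fintype.card ι * (M + N).charpoly := by
  have key : Matrix.charmatrix M * Matrix.charmatrix N
      = (X : R[X]) • Matrix.charmatrix (M + N) := by
    have h' : C.mapMatrix M * C.mapMatrix N = 0 := by rw [← map_mul, h, map_zero]
    simp only [Matrix.charmatrix, map_add, sub_mul, mul_sub, h', ← Matrix.smul_eq_diagonal_mul,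
      Matrix.scalar_apply]
    simp only [← Matrix.smul_one_eq_diagonal, mul_smul_comm, mul_one,
      smul_sub, smul_add]
    abel
  simp only [Matrix.charpoly]
  rw [← Matrix.det_mul, key, Matrix.det_smul]

open Polynomial in
theorem charpoly_skewMat_smul_wedge (hn : 2 ≤ n) (σ : ℝ) {x y : Vec n} (hx : ‖x‖ = 1)
    (hy : ‖y‖ = 1) (hxy : inner ℝ x y = 0) :
    (skewMat (σ • wedge (vec x) (vec y))).charpoly = X ^ (n - 2) * (X ^ 2 + C (σ ^ 2)) := by
  -- A rank-two factorization `U V`: its characteristic polynomial is `X ^ (n - 2)` times that of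
  -- the 2 × 2 matrix `V U`.
  let U : Matrix (Fin n) (Fin 2) ℝ := Matrix.of fun i => ![σ * x i, σ * y i]
  let V : Matrix (Fin 2) (Fin n) ℝ := Matrix.of ![fun i => y i, fun i => -x i]
  have hUV : skewMat (σ • wedge (vec x) (vec y)) = U * V := by
    ext i j
    simp [skewMat_smul, skewMat_wedge, U, V, Matrix.mul_apply, Fin.sum_univ_two]
    ring
  have hs : ∀ a b : Vec n, ∑ i, a i * b i = inner ℝ a b := by
    intro a b
    simp [PiLp.inner_apply, mul_comm]
  have hVU : V * U = !![0, σ; -σ, 0] := by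
    ext i j
    have h1 : ∀ a b : Vec n, ∑ i, a i * (σ * b i) = σ * inner ℝ a b := by
      intro a b; rw [← hs, Finset.mul_sum]; exact Finset.sum_congr rfl fun i _ => by ring
    fin_cases i <;> fin_cases j <;>
      simp [U, V, Matrix.mul_apply, h1, hx, hy, hxy, real_inner_comm]
  rw [hUV, Matrix.charpoly_mul_comm_of_le _ _ (by simpa using hn), hVU, Fintype.card_fin,
    Fintype.card_fin]
  congr 1
  rw [Matrix.charpoly, Matrix.det_fin_two]
  simp
  ring

end Bivectors

/-! ## Top singular vectors and the decomposition -/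

section Decomposition

variable {n : ℕ}

/-- The equality case of Cauchy–Schwarz: expanding, `‖A² w + σ² w‖² = ‖A² w‖² - 2σ⁴ + σ⁴ ≤ 0`. -/
theorem contr_contr_of_norm_eq {b : Cl n} (hb : b ∈ Cl2 n) {σ : ℝ}
    (htop : ∀ x : Vec n, ‖contr b x‖ ≤ σ * ‖x‖) {w : Vec n} (hw : ‖w‖ = 1)
    (hσ : ‖contr b w‖ = σ) : contr b (contr b w) = -(σ ^ 2 • w) := by
  have h0 : 0 ≤ σ := hσ ▸ norm_nonneg _
  have h1 : ‖contr b (contr b w)‖ ≤ σ * σ := by simpa [hσ] using htop (contr b w)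
  have h2 : inner ℝ (contr b (contr b w)) w = -σ ^ 2 := by
    rw [inner_contr hb, real_inner_self_eq_norm_sq, hσ]
  have h3 : ‖contr b (contr b w) + σ ^ 2 • w‖ ^ 2 ≤ 0 := by
    rw [norm_add_sq_real, real_inner_smul_right, h2, norm_smul, hw, Real.norm_eq_abs,
      abs_of_nonneg (sq_nonneg σ)]
    nlinarith [norm_nonneg (contr b (contr b w))]
  have h4 : contr b (contr b w) + σ ^ 2 • w = 0 := by
    rw [← norm_eq_zero]
    exact pow_eq_zero_iff two_ne_zero |>.mp (le_antisymm h3 (sq_nonneg _))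
  exact eq_neg_of_add_eq_zero_left h4

theorem isTopSingular_of_contr_contr {b : Cl n} (hb : b ∈ Cl2 n) {σ : ℝ} (hσ : 0 < σ)
    (htop : ∀ x : Vec n, ‖contr b x‖ ≤ σ * ‖x‖) {w : Vec n} (hw : ‖w‖ = 1)
    (h : contr b (contr b w) = -(σ ^ 2 • w)) : IsTopSingular b σ (σ⁻¹ • contr b w) w where
  norm_left := by
    have h1 : ‖contr b w‖ ^ 2 = σ ^ 2 := by
      rw [← real_inner_self_eq_norm_sq, inner_contr hb, h, inner_neg_right, real_inner_smul_right,
        real_inner_self_eq_norm_sq, hw]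
      ring
    have h2 : ‖contr b w‖ = σ := by
      rwa [sq_eq_sq₀ (norm_nonneg _) hσ.le] at h1
    rw [norm_smul, h2, norm_inv, Real.norm_eq_abs, abs_of_pos hσ, inv_mul_cancel₀ hσ.ne']
  norm_right := hw
  map_right := by rw [smul_inv_smul₀ hσ.ne']
  map_left := by
    rw [adjoint_contr hb, LinearMap.neg_apply, map_smul, h, smul_neg, neg_neg, smul_smul]
    congr 1
    field_simp
  top := htop

/-- The largest singular value of `x ↦ b ⌞ x`. -/
noncomputable def topSV (b : Cl n) : ℝ := ‖LinearMap.toContinuousLinearMap (contr b)‖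

theorem norm_contr_le (b : Cl n) (x : Vec n) : ‖contr b x‖ ≤ topSV b * ‖x‖ :=
  (LinearMap.toContinuousLinearMap (contr b)).le_opNorm x

theorem topSV_nonneg (b : Cl n) : 0 ≤ topSV b := norm_nonneg _

theorem topSV_pos {b : Cl n} (hb : b ∈ Cl2 n) (h : b ≠ 0) : 0 < topSV b := by
  refine (topSV_nonneg b).lt_of_ne fun h0 => h (eq_zero_of_contr_eq_zero hb ?_)
  ext1 x
  simpa [← h0] using norm_contr_le b x

theorem IsTopSingular.eq_topSV {b : Cl n} {σ : ℝ} {u v : Vec n} (h : IsTopSingular b σ u v) :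
    σ = topSV b := by
  have h1 : ‖contr b v‖ = |σ| := by simp [h.map_right, norm_smul, h.norm_left]
  have h0 : 0 ≤ σ := by simpa [h.norm_right] using (norm_nonneg _).trans (h.top v)
  refine le_antisymm ?_ (ContinuousLinearMap.opNorm_le_bound _ h0 h.top)
  have := norm_contr_le b v
  rwa [h1, h.norm_right, mul_one, abs_of_nonneg h0] at this

theorem IsTopSingular.nonneg {b : Cl n} {σ : ℝ} {u v : Vec n} (h : IsTopSingular b σ u v) :
    0 ≤ σ := h.eq_topSV ▸ topSV_nonneg b

theorem IsTopSingular.contr_left {b : Cl n} (hb : b ∈ Cl2 n) {σ : ℝ} {u v : Vec n}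
    (h : IsTopSingular b σ u v) : contr b u = -(σ • v) := by
  rw [← h.map_left, adjoint_contr hb]; simp

theorem IsTopSingular.inner_eq_zero {b : Cl n} (hb : b ∈ Cl2 n) {σ : ℝ} {u v : Vec n}
    (h : IsTopSingular b σ u v) (hσ : σ ≠ 0) : inner ℝ u v = 0 := by
  have := inner_contr_self hb v
  rw [h.map_right, real_inner_smul_right, real_inner_comm] at this
  exact (mul_eq_zero.mp this).resolve_left hσ

theorem exists_isTopSingular (hn : 0 < n) {b : Cl n} (hb : b ∈ Cl2 n) :
    ∃ (σ : ℝ) (u v : Vec n), IsTopSingular b σ u v := by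
  have hne : (Metric.sphere (0 : Vec n) 1).Nonempty :=
    ⟨stdVec ⟨0, hn⟩, by simp⟩
  have hcont : Continuous fun x : Vec n => ‖contr b x‖ :=
    (LinearMap.toContinuousLinearMap (contr b)).continuous.norm
  obtain ⟨w, hw, hmax⟩ := (isCompact_sphere (0 : Vec n) 1).exists_isMaxOn hne hcont.continuousOn
  have hw1 : ‖w‖ = 1 := by simpa using hw
  have htop : ∀ x : Vec n, ‖contr b x‖ ≤ ‖contr b w‖ * ‖x‖ := by
    intro x
    by_cases hx : x = 0
    · simp [hx]
    have hx' : 0 < ‖x‖ := norm_pos_iff.mpr hx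
    have h1 : ‖contr b (‖x‖⁻¹ • x)‖ ≤ ‖contr b w‖ :=
      hmax (by simp [norm_smul, hx'.ne'])
    rw [map_smul, norm_smul, norm_inv, norm_norm, inv_mul_le_iff₀ hx'] at h1
    linarith
  by_cases h0 : ‖contr b w‖ = 0
  · have hz : contr b = 0 := by
      ext1 x
      simpa [h0] using htop x
    exact ⟨0, w, w, hw1, hw1, by simp [hz], by simp [hz], by simp [hz]⟩
  · exact ⟨_, _, _, isTopSingular_of_contr_contr hb ((norm_nonneg _).lt_of_ne' h0) htop hw1
      (contr_contr_of_norm_eq hb htop hw1 rfl)⟩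

theorem IsSimpleProj.mem_Cl2 {b s : Cl n} {w : Vec n} (h : IsSimpleProj b s w) : s ∈ Cl2 n := by
  obtain ⟨-, rfl⟩ | ⟨σ, u, -, rfl⟩ := h
  · exact zero_mem _
  · exact Submodule.smul_mem _ _ (wedge_vec_mem_Cl2 _ _)

/-- `σ (u ∧ v)` is a dominant simple component of `b`, with singular vectors in `W`. -/
structure IsDominant (b : Cl n) (W : Submodule ℝ (Vec n)) (σ : ℝ) (u v : Vec n) : Prop where
  nonneg : 0 ≤ σ
  norm_left : ‖u‖ = 1
  norm_right : ‖v‖ = 1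
  ortho : inner ℝ u v = 0
  mem_left : u ∈ W
  mem_right : v ∈ W
  map_right : contr b v = σ • u
  map_left : contr b u = -(σ • v)
  top : ∀ x : Vec n, ‖contr b x‖ ≤ σ * ‖x‖

theorem exists_orthonormal_pair {W : Submodule ℝ (Vec n)} (hW : 2 ≤ Module.finrank ℝ W) :
    ∃ u v : Vec n, u ∈ W ∧ v ∈ W ∧ ‖u‖ = 1 ∧ ‖v‖ = 1 ∧ inner ℝ u v = 0 := by
  let e := stdOrthonormalBasis ℝ W
  have h01 : (⟨0, by omega⟩ : Fin (Module.finrank ℝ W)) ≠ ⟨1, by omega⟩ := by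
    simp [Fin.ext_iff]
  refine ⟨e ⟨0, by omega⟩, e ⟨1, by omega⟩, (e _).2, (e _).2, ?_, ?_, ?_⟩
  · exact e.orthonormal.1 _
  · exact e.orthonormal.1 _
  · exact e.orthonormal.2 h01

/-- This removes the case distinction on `b = 0` from the induction: when `σ = 0` any orthonormal
pair in `W` serves, and otherwise both singular vectors lie in the range of `b`, hence in `W`. -/
theorem IsSimpleProj.exists_isDominant {b s : Cl n} {w : Vec n} (hb : b ∈ Cl2 n)
    (h : IsSimpleProj b s w) {W : Submodule ℝ (Vec n)} (hW : 2 ≤ Module.finrank ℝ W)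
    (hbW : ∀ z, contr b z ∈ W) :
    ∃ (σ : ℝ) (u v : Vec n), IsDominant b W σ u v ∧ s = σ • wedge (vec u) (vec v) ∧
      (s ≠ 0 → w = v) := by
  have hzero : b = 0 → s = 0 → ∃ (σ : ℝ) (u v : Vec n), IsDominant b W σ u v ∧
      s = σ • wedge (vec u) (vec v) ∧ (s ≠ 0 → w = v) := by
    rintro rfl rfl
    obtain ⟨u, v, hu, hv, hu1, hv1, huv⟩ := exists_orthonormal_pair hW
    exact ⟨0, u, v, ⟨le_rfl, hu1, hv1, huv, hu, hv, by simp [contr_zero], by simp [contr_zero],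
      by simp [contr_zero]⟩, by simp, by simp⟩
  obtain ⟨hb0, hs0⟩ | ⟨σ, u, ht, hs⟩ := h
  · exact hzero hb0 hs0
  -- For `σ = 0`, `IsTopSingular` forces neither `u ⊥ w` nor membership in `W`, so the pair is
  -- chosen afresh.
  · by_cases hσ : σ = 0
    · refine hzero (eq_zero_of_contr_eq_zero hb ?_) (by simp [hs, hσ])
      ext1 x
      simpa [hσ] using ht.top x
    · have hu : σ • u ∈ W := ht.map_right ▸ hbW w
      have hv : -(σ • w) ∈ W := ht.contr_left hb ▸ hbW u
      exact ⟨σ, u, w, ⟨ht.nonneg, ht.norm_left, ht.norm_right, ht.inner_eq_zero hb hσ,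
        (Submodule.smul_mem_iff _ hσ).mp hu,
        (Submodule.smul_mem_iff _ hσ).mp ((neg_mem_iff).mp hv), ht.map_right, ht.contr_left hb,
        ht.top⟩, hs, fun _ => rfl⟩

/-! ### Deflation: the residual after removing a dominant simple component -/

namespace IsDominant

variable {b : Cl n} {W : Submodule ℝ (Vec n)} {σ : ℝ} {u v : Vec n}

theorem contr_residual (x : Vec n) :
    contr (b - σ • wedge (vec u) (vec v)) x =
      contr b x - σ • (inner ℝ v x • u - inner ℝ u x • v) := by
  simp [contr_sub, contr_smul, contr_wedge]

theorem residual_left (h : IsDominant b W σ u v) :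
    contr (b - σ • wedge (vec u) (vec v)) u = 0 := by
  rw [contr_residual, h.map_left, real_inner_comm, h.ortho, real_inner_self_eq_norm_sq,
    h.norm_left]
  simp

theorem residual_right (h : IsDominant b W σ u v) :
    contr (b - σ • wedge (vec u) (vec v)) v = 0 := by
  rw [contr_residual, h.map_right, h.ortho, real_inner_self_eq_norm_sq, h.norm_right]
  simp

theorem residual_bound (h : IsDominant b W σ u v) {C : ℝ}
    (hC : ∀ x : Vec n, ‖contr b x‖ ≤ C * ‖x‖) (x : Vec n) :
    ‖contr (b - σ • wedge (vec u) (vec v)) x‖ ≤ C * ‖x‖ := by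
  have hC0 : 0 ≤ C := by
    have := (norm_nonneg _).trans (hC u)
    rwa [h.norm_left, mul_one] at this
  -- The residual at `x` is `b` at the component of `x` orthogonal to the plane, which is no longer
  -- than `x`.
  set x' := x - inner ℝ u x • u - inner ℝ v x • v with hx'
  have h1 : contr (b - σ • wedge (vec u) (vec v)) x = contr b x' := by
    rw [contr_residual, hx', map_sub, map_sub, map_smul, map_smul, h.map_left, h.map_right]
    module
  have h2 : ‖x'‖ ^ 2 = ‖x‖ ^ 2 - inner ℝ u x ^ 2 - inner ℝ v x ^ 2 := by
    have hvu : inner ℝ v u = 0 := by rw [real_inner_comm, h.ortho]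
    simp only [← real_inner_self_eq_norm_sq, hx', inner_sub_left, inner_sub_right,
      real_inner_smul_left, real_inner_smul_right, h.ortho, hvu]
    rw [real_inner_self_eq_norm_sq u, real_inner_self_eq_norm_sq v, h.norm_left, h.norm_right,
      real_inner_comm u x, real_inner_comm v x]
    ring
  have h3 : ‖x'‖ ≤ ‖x‖ := by
    rw [← sq_le_sq₀ (norm_nonneg _) (norm_nonneg _), h2]
    nlinarith [sq_nonneg (inner ℝ u x), sq_nonneg (inner ℝ v x)]
  rw [h1]
  exact (hC x').trans (mul_le_mul_of_nonneg_left h3 hC0)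

theorem residual_mem (h : IsDominant b W σ u v) (hb : b ∈ Cl2 n) (hbW : ∀ z, contr b z ∈ W)
    (z : Vec n) : contr (b - σ • wedge (vec u) (vec v)) z ∈ (Submodule.span ℝ {u, v})ᗮ ⊓ W := by
  have hr : b - σ • wedge (vec u) (vec v) ∈ Cl2 n :=
    Submodule.sub_mem _ hb (Submodule.smul_mem _ _ (wedge_vec_mem_Cl2 _ _))
  refine ⟨?_, ?_⟩
  · rw [SetLike.mem_coe, Submodule.mem_orthogonal']
    intro y hy
    obtain ⟨a, c, rfl⟩ := Submodule.mem_span_pair.mp hy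
    rw [inner_contr hr, map_add, map_smul, map_smul, h.residual_left, h.residual_right]
    simp
  · rw [contr_residual]
    exact W.sub_mem (hbW z) (W.smul_mem _ (W.sub_mem (W.smul_mem _ h.mem_left)
      (W.smul_mem _ h.mem_right)))

theorem finrank_residual (h : IsDominant b W σ u v) :
    2 + Module.finrank ℝ ((Submodule.span ℝ {u, v})ᗮ ⊓ W : Submodule ℝ (Vec n)) =
      Module.finrank ℝ W := by
  have hle : Submodule.span ℝ {u, v} ≤ W := by
    rw [Submodule.span_le]
    rintro x (rfl | rfl)
    · exact h.mem_left
    · exact h.mem_right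
  have hon : Orthonormal ℝ ![u, v] := by
    rw [orthonormal_iff_ite]
    have hvu : inner ℝ v u = 0 := by rw [real_inner_comm, h.ortho]
    intro i j
    fin_cases i <;> fin_cases j <;> simp [h.norm_left, h.norm_right, h.ortho, hvu]
  have h2 : Module.finrank ℝ (Submodule.span ℝ {u, v}) = 2 := by
    have := finrank_span_eq_card hon.linearIndependent
    rwa [Matrix.range_cons_cons_empty, Fintype.card_fin] at this
  have := Submodule.finrank_add_inf_finrank_orthogonal hle
  rwa [h2] at this

end IsDominant

/-- If the range lies in the line of `w`, then `b w` is a multiple of `w` orthogonal to `w`, so it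
vanishes; then `‖b z‖² = -⟪z, b (b z)⟫ = 0`. -/
theorem eq_zero_of_finrank_le_one {b : Cl n} (hb : b ∈ Cl2 n) {W : Submodule ℝ (Vec n)}
    (hW : Module.finrank ℝ W ≤ 1) (hbW : ∀ z, contr b z ∈ W) : b = 0 := by
  refine eq_zero_of_contr_eq_zero hb ?_
  ext1 z
  obtain ⟨w, hw⟩ := finrank_le_one_iff.mp hW
  obtain ⟨a, ha⟩ := hw ⟨_, hbW z⟩
  obtain ⟨c, hc⟩ := hw ⟨_, hbW w⟩
  have ha' : contr b z = a • (w : Vec n) := by simpa using (congrArg Subtype.val ha).symm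
  have hc' : contr b w = c • (w : Vec n) := by simpa using (congrArg Subtype.val hc).symm
  have h1 : c * inner ℝ (w : Vec n) (w : Vec n) = 0 := by
    rw [← real_inner_smul_right, ← hc', inner_contr_self hb]
  have h2 : contr b (w : Vec n) = 0 := by
    rcases mul_eq_zero.mp h1 with h | h
    · rw [hc', h, zero_smul]
    · rw [inner_self_eq_zero.mp h, map_zero]
  have h3 : inner ℝ (contr b z) (contr b z) = 0 := by
    conv_lhs => rw [inner_contr hb, ha', map_smul, h2]
    simp
  simpa using h3

/-- The data carried along the run of the decomposition algorithm: orthonormal singular vectors in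
`W` whose weighted wedge products are the bivectors `d j`. -/
structure IsSingularSystem {m : ℕ} (b : Cl n) (W : Submodule ℝ (Vec n)) (d : Fin (m + 1) → Cl n)
    (w : Fin m → Vec n) (σ : Fin (m + 1) → ℝ) (x y : Fin (m + 1) → Vec n) : Prop where
  anti : Antitone σ
  nonneg : ∀ j, 0 ≤ σ j
  orthonormal_left : Orthonormal ℝ x
  orthonormal_right : Orthonormal ℝ y
  ortho : ∀ i j, inner ℝ (x i) (y j) = 0
  mem_left : ∀ j, x j ∈ W
  mem_right : ∀ j, y j ∈ W
  eq_wedge : ∀ j, d j = σ j • wedge (vec (x j)) (vec (y j))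
  sum_eq : ∑ j, d j = b
  le_bound : ∀ C : ℝ, (∀ z : Vec n, ‖contr b z‖ ≤ C * ‖z‖) → ∀ j, σ j ≤ C
  vector_eq : ∀ i : Fin m, d i.castSucc ≠ 0 → w i = y i.castSucc

/-! ### The run of the algorithm by induction -/

theorem orthonormal_finCons {E : Type*} [NormedAddCommGroup E] [InnerProductSpace ℝ E] {m : ℕ}
    {u : E} {x : Fin m → E} (hu : ‖u‖ = 1) (hx : Orthonormal ℝ x)
    (hux : ∀ j, inner ℝ u (x j) = 0) :
    Orthonormal ℝ (Fin.cons u x : Fin (m + 1) → E) := by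
  refine ⟨fun i => ?_, fun i j hij => ?_⟩
  · cases i using Fin.cases with
    | zero => simpa using hu
    | succ i => simpa using hx.1 i
  · cases i using Fin.cases with
    | zero =>
      cases j using Fin.cases with
      | zero => exact absurd rfl hij
      | succ j => simpa using hux j
    | succ i =>
      cases j using Fin.cases with
      | zero => simpa [real_inner_comm] using hux i
      | succ j => simpa using hx.2 (fun h => hij (by rw [h]))

theorem antitone_finCons {m : ℕ} {a : ℝ} {f : Fin m → ℝ} (hf : Antitone f) (ha : ∀ j, f j ≤ a) :
    Antitone (Fin.cons a f : Fin (m + 1) → ℝ) := by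
  intro i j hij
  cases i using Fin.cases with
  | zero =>
    cases j using Fin.cases with
    | zero => exact le_rfl
    | succ j => simpa using ha j
  | succ i =>
    cases j using Fin.cases with
    | zero => exact absurd hij (by simp)
    | succ j => simpa using hf (by simpa using hij)

/-- The induction generalizes from the whole space to any `W` containing the range of the residual.
Halving its dimension with rounding treats both parities of `n` at once. -/
theorem exists_isSingularSystem (proj : Cl n → Vec n → Cl n × Vec n) (m : ℕ) :
    ∀ (b : Cl n) (v : Fin m → Vec n) (W : Submodule ℝ (Vec n)), b ∈ Cl2 n →
      Module.finrank ℝ W / 2 = m + 1 → (∀ z, contr b z ∈ W) →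
      AlongRun proj (fun r x => IsSimpleProj r (proj r x).1 (proj r x).2) m b v →
      ∃ (σ : Fin (m + 1) → ℝ) (x y : Fin (m + 1) → Vec n),
        IsSingularSystem b W (invDecomp proj m b v).1 (invDecomp proj m b v).2 σ x y := by
  induction m with
  | zero =>
    intro b v W hb hW hbW _
    have hn : 0 < n := by
      have := Submodule.finrank_le W
      rw [finrank_euclideanSpace_fin] at this
      omega
    obtain ⟨σ, u, v', ht⟩ := exists_isTopSingular hn hb
    obtain ⟨σ, u, v', hd, -, -⟩ :=
      IsSimpleProj.exists_isDominant hb (Or.inr ⟨σ, u, ht, rfl⟩) (by omega : 2 ≤ _) hbW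
    -- No subroutine is called for the last term. Here `W` has dimension 2 or 3, so after removing
    -- one dominant plane the range lies in dimension at most 1.
    have hr : b - σ • wedge (vec u) (vec v') = 0 := by
      refine eq_zero_of_finrank_le_one
        (Submodule.sub_mem _ hb (Submodule.smul_mem _ _ (wedge_vec_mem_Cl2 _ _)))
        (W := (Submodule.span ℝ {u, v'})ᗮ ⊓ W) ?_ (hd.residual_mem hb hbW)
      have := hd.finrank_residual
      omega
    refine ⟨fun _ => σ, fun _ => u, fun _ => v', ?_, fun _ => hd.nonneg, ?_, ?_,
      fun _ _ => hd.ortho, fun _ => hd.mem_left, fun _ => hd.mem_right,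
      fun _ => sub_eq_zero.mp hr, by simp [invDecomp], ?_, fun i => i.elim0⟩
    · exact fun _ _ _ => le_rfl
    · exact ⟨fun _ => hd.norm_left, fun i j h => absurd (Fin.ext (by omega)) h⟩
    · exact ⟨fun _ => hd.norm_right, fun i j h => absurd (Fin.ext (by omega)) h⟩
    · intro C hC _
      have := hC v'
      rwa [hd.map_right, norm_smul, hd.norm_left, hd.norm_right, mul_one, mul_one,
        Real.norm_eq_abs, abs_of_nonneg hd.nonneg] at this
  | succ m ih =>
    intro b v W hb hW hbW hrun
    obtain ⟨hp, hrun⟩ := hrun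
    obtain ⟨σ, u, w, hd, hs, hw⟩ := hp.exists_isDominant hb (by omega) hbW
    have hr : b - (proj b (v 0)).1 ∈ Cl2 n := Submodule.sub_mem _ hb hp.mem_Cl2
    have hdim := hd.finrank_residual
    obtain ⟨σ', x, y, H⟩ := ih (b - (proj b (v 0)).1) (Fin.tail v)
      ((Submodule.span ℝ {u, w})ᗮ ⊓ W) hr (by omega)
      (by rw [hs]; exact hd.residual_mem hb hbW) hrun
    have hortho : ∀ z ∈ (Submodule.span ℝ {u, w})ᗮ ⊓ W, inner ℝ u z = 0 ∧ inner ℝ w z = 0 := by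
      intro z hz
      have hz1 := (Submodule.mem_orthogonal _ _).mp hz.1
      exact ⟨hz1 u (Submodule.subset_span (by simp)), hz1 w (Submodule.subset_span (by simp))⟩
    -- Every bound for `b` also bounds the residual; applied with `C = σ`, this makes the singular
    -- values decrease.
    have hbound : ∀ C : ℝ, (∀ z : Vec n, ‖contr b z‖ ≤ C * ‖z‖) → ∀ j, σ' j ≤ C := by
      intro C hC
      refine H.le_bound C ?_
      rw [hs]
      exact hd.residual_bound hC
    refine ⟨Fin.cons σ σ', Fin.cons u x, Fin.cons w y, ?_⟩
    constructor
    · exact antitone_finCons H.anti (hbound σ hd.top)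
    · exact Fin.cases hd.nonneg H.nonneg
    · exact orthonormal_finCons hd.norm_left H.orthonormal_left
        fun j => (hortho _ (H.mem_left j)).1
    · exact orthonormal_finCons hd.norm_right H.orthonormal_right
        fun j => (hortho _ (H.mem_right j)).2
    · refine Fin.cases (Fin.cases hd.ortho fun j => ?_) fun i => Fin.cases ?_ fun j => ?_
      · simpa using (hortho _ (H.mem_right j)).1
      · simpa [real_inner_comm] using (hortho _ (H.mem_left i)).2
      · simpa using H.ortho i j
    · exact Fin.cases hd.mem_left fun j => (H.mem_left j).2
    · exact Fin.cases hd.mem_right fun j => (H.mem_right j).2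
    · exact Fin.cases hs H.eq_wedge
    · rw [Fin.sum_univ_succ]
      simp only [invDecomp, Fin.cons_zero, Fin.cons_succ]
      rw [H.sum_eq, add_sub_cancel]
    · intro C hC
      refine Fin.cases ?_ (hbound C hC)
      have := hC w
      rwa [hd.map_right, norm_smul, hd.norm_left, hd.norm_right, mul_one, mul_one,
        Real.norm_eq_abs, abs_of_nonneg hd.nonneg] at this
    · refine Fin.cases hw fun i => ?_
      simpa [invDecomp, ← Fin.succ_castSucc] using H.vector_eq i

/-! ### Spectrum and correctness of the output -/

theorem contr_sum_wedge {k : ℕ} {x y : Fin k → Vec n} (σ : Fin k → ℝ) (z : Vec n) :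
    contr (∑ j, σ j • wedge (vec (x j)) (vec (y j))) z =
      ∑ j, σ j • (inner ℝ (y j) z • x j - inner ℝ (x j) z • y j) := by
  simp [contr_sum, contr_smul, contr_wedge]

theorem orthonormal_comp_castSucc {k : ℕ} {x : Fin (k + 1) → Vec n} (hx : Orthonormal ℝ x) :
    Orthonormal ℝ fun j : Fin k => x j.castSucc :=
  hx.comp _ (Fin.castSucc_injective k)

open Polynomial in
theorem charpoly_skewMat_sum {k : ℕ} (hk : 2 * k ≤ n) {x y : Fin k → Vec n}
    (hx : Orthonormal ℝ x) (hy : Orthonormal ℝ y) (hxy : ∀ i j, inner ℝ (x i) (y j) = 0)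
    (σ : Fin k → ℝ) :
    (skewMat (∑ j, σ j • wedge (vec (x j)) (vec (y j)))).charpoly =
      X ^ (n - 2 * k) * ∏ j, (X ^ 2 + C (σ j ^ 2)) := by
  induction k with
  | zero => simp [skewMat_zero, Matrix.charpoly_zero]
  | succ k ih =>
    have IH := ih (by omega) (orthonormal_comp_castSucc hx) (orthonormal_comp_castSucc hy)
      (fun i j => hxy _ _) (fun j => σ j.castSucc)
    have hyx : ∀ i j, inner ℝ (y i) (x j) = 0 := fun i j => by rw [real_inner_comm, hxy]
    have hx0 : ∀ j : Fin k, inner ℝ (x j.castSucc) (x (Fin.last k)) = 0 :=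
      fun j => hx.2 (Fin.castSucc_lt_last j).ne
    have hy0 : ∀ j : Fin k, inner ℝ (y j.castSucc) (y (Fin.last k)) = 0 :=
      fun j => hy.2 (Fin.castSucc_lt_last j).ne
    -- Blocks on mutually orthogonal planes multiply to zero.
    have hmul : skewMat (∑ j : Fin k, σ j.castSucc •
          wedge (vec (x j.castSucc)) (vec (y j.castSucc))) *
        skewMat (σ (Fin.last k) • wedge (vec (x (Fin.last k))) (vec (y (Fin.last k)))) = 0 := by
      ext i j
      rw [skewMat_mul, contr_sum_wedge, contr_smul, LinearMap.smul_apply, contr_wedge]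
      simp [inner_sub_right, real_inner_smul_right, hx0, hy0, hxy, hyx]
    have key := charpoly_mul_charpoly_of_mul_eq_zero hmul
    rw [IH, charpoly_skewMat_smul_wedge (by omega) _ (hx.1 _) (hy.1 _) (hxy _ _),
      Fintype.card_fin, ← skewMat_add] at key
    rw [Fin.sum_univ_castSucc, Fin.prod_univ_castSucc]
    refine mul_left_cancel₀ (pow_ne_zero n (X_ne_zero (R := ℝ))) ?_
    rw [← key]
    have h1 : (X : ℝ[X]) ^ (n - 2 * k) * X ^ (n - 2) = X ^ n * X ^ (n - 2 * (k + 1)) := by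
      rw [← pow_add, ← pow_add]; congr 1; omega
    linear_combination (∏ j : Fin k, (X ^ 2 + C (σ j.castSucc ^ 2))) *
      (X ^ 2 + C (σ (Fin.last k) ^ 2)) * h1

open Polynomial in
theorem IsSingularSystem.isCorrectOutput {m : ℕ} (hm : 2 * (m + 1) ≤ n) {b : Cl n}
    {W : Submodule ℝ (Vec n)} {d : Fin (m + 1) → Cl n} {w : Fin m → Vec n} {σ : Fin (m + 1) → ℝ}
    {x y : Fin (m + 1) → Vec n} (H : IsSingularSystem b W d w σ x y) : IsCorrectOutput b d w := by
  have hb : b = ∑ j, σ j • wedge (vec (x j)) (vec (y j)) := by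
    rw [← H.sum_eq]; exact Finset.sum_congr rfl fun j _ => H.eq_wedge j
  have hyx : ∀ i j, inner ℝ (y i) (x j) = 0 := fun i j => by rw [real_inner_comm, H.ortho]
  have hxx := orthonormal_iff_ite.mp H.orthonormal_left
  have hyy := orthonormal_iff_ite.mp H.orthonormal_right
  have hby : ∀ j, contr b (y j) = σ j • x j := by
    intro j
    rw [hb, contr_sum_wedge]
    simp [hyy, H.ortho]
  have hbx : ∀ j, contr b (x j) = -(σ j • y j) := by
    intro j
    rw [hb, contr_sum_wedge]
    simp [hxx, hyx]
  refine ⟨⟨H.sum_eq, fun j => ⟨σ j • x j, y j, ?_⟩, fun i j => ?_, fun i j hij => ?_⟩,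
    σ, x, y, H.anti, H.nonneg, ?_, fun j => ⟨hby j, hbx j⟩, H.eq_wedge, fun j => ?_, ?_,
    H.vector_eq⟩
  · rw [H.eq_wedge]
    rw [wedge_vec_smul_left]
  · rw [H.eq_wedge, H.eq_wedge]
    by_cases hij : i = j
    · rw [hij]
    · rw [smul_mul_smul_comm, smul_mul_smul_comm, mul_comm (σ j), wedge_comm_of_ortho (H.ortho _ _)
        (H.ortho _ _) (H.orthonormal_left.2 hij) (H.ortho _ _) (hyx _ _)
        (H.orthonormal_right.2 hij)]
  · rw [H.eq_wedge, H.eq_wedge, map_smul, smul_mul_smul_comm, scalarPart_smul,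
      scalarPart_reverse_mul (H.ortho _ _) (H.ortho _ _) (hyx _ _) (H.orthonormal_right.2 hij),
      mul_zero]
  · rw [orthonormal_iff_ite]
    rintro (i | i) (j | j)
    · simpa using hxx i j
    · simpa using H.ortho i j
    · simpa using hyx i j
    · simpa using hyy i j
  · rw [H.eq_wedge]
    exact isSpectralTerm_of_singular (H.orthonormal_left.1 j) (H.orthonormal_right.1 j) (hby j)
      (hbx j)
  · have h1 := charpoly_skewMat_sum hm H.orthonormal_left H.orthonormal_right H.ortho σ
    rw [← hb] at h1
    have h2 := Matrix.charpoly_map (skewMat b) Complex.ofRealHom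
    have h3 : cMat b = (skewMat b).map Complex.ofRealHom := rfl
    rw [h3, h2, h1, Polynomial.map_mul, Polynomial.map_prod, Polynomial.map_pow, map_X]
    congr 1
    refine Finset.prod_congr rfl fun j _ => ?_
    simp only [Polynomial.map_add, Polynomial.map_pow, map_X, map_C, Complex.ofRealHom_eq_coe]
    have : (C ((σ j ^ 2 : ℝ) : ℂ)) = -(C (Complex.I * σ j) ^ 2) := by
      rw [← C_pow, ← C_neg, mul_pow, Complex.I_sq]; simp
    rw [this]; ring

theorem isCorrectOutput_invDecomp {m : ℕ} (hm : m + 1 = n / 2)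
    {proj : Cl n → Vec n → Cl n × Vec n} {b : Cl n} (hb : b ∈ Cl2 n) {v : Fin m → Vec n}
    (h : AlongRun proj (fun r x => IsSimpleProj r (proj r x).1 (proj r x).2) m b v) :
    IsCorrectOutput b (invDecomp proj m b v).1 (invDecomp proj m b v).2 := by
  obtain ⟨σ, x, y, H⟩ := exists_isSingularSystem proj m b v ⊤ hb
    (by rw [finrank_top, finrank_euclideanSpace_fin, hm]) (fun _ => Submodule.mem_top) h
  exact H.isCorrectOutput (by omega)

end Decomposition

/-! ## The power iteration -/

section PowerIteration

/-- In an orthonormal eigenbasis the eigenvalues lie in `[0, 1]`, and their powers tend to 1 or to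
0. -/
theorem LinearMap.IsSymmetric.exists_tendsto_pow {E : Type*} [NormedAddCommGroup E]
    [InnerProductSpace ℝ E] [FiniteDimensional ℝ E] {T : Module.End ℝ E} (hT : T.IsSymmetric)
    (h0 : ∀ x, 0 ≤ inner ℝ (T x) x) (h1 : ∀ x, ‖T x‖ ≤ ‖x‖) (x : E) :
    ∃ L, Tendsto (fun t : ℕ => (T ^ t) x) atTop (𝓝 L) ∧ T L = L := by
  let e := hT.eigenvectorBasis rfl
  let c := hT.eigenvalues rfl
  have he : ∀ i, T (e i) = c i • e i := fun i => hT.apply_eigenvectorBasis rfl i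
  have hc0 : ∀ i, 0 ≤ c i := by
    intro i
    have := h0 (e i)
    rwa [he, real_inner_smul_left, real_inner_self_eq_norm_sq, e.orthonormal.1 i, one_pow,
      mul_one] at this
  have hc1 : ∀ i, c i ≤ 1 := by
    intro i
    have := h1 (e i)
    rw [he, norm_smul, e.orthonormal.1 i, mul_one] at this
    exact (le_abs_self _).trans this
  have hpow : ∀ t : ℕ, (T ^ t) x = ∑ i, c i ^ t • (inner ℝ (e i) x • e i) := by
    intro t
    induction t with
    | zero => simpa using (e.sum_repr' x).symm
    | succ t ih =>
      rw [pow_succ', Module.End.mul_apply, ih, map_sum]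
      refine Finset.sum_congr rfl fun i _ => ?_
      rw [map_smul, map_smul, he, pow_succ, mul_smul, smul_comm (inner ℝ (e i) x)]
  refine ⟨∑ i, (if c i = 1 then (1 : ℝ) else 0) • (inner ℝ (e i) x • e i), ?_, ?_⟩
  · simp only [hpow]
    refine tendsto_finsetSum _ fun i _ => Tendsto.smul_const ?_ _
    by_cases h : c i = 1
    · rw [if_pos h]
      exact tendsto_const_nhds.congr fun t => by rw [h, one_pow]
    · simpa [h] using tendsto_pow_atTop_nhds_zero_of_lt_one (hc0 i) ((hc1 i).lt_of_ne h)
  · rw [map_sum]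
    refine Finset.sum_congr rfl fun i _ => ?_
    by_cases h : c i = 1
    · simp [h, he]
    · simp [h]

variable {n : ℕ}

/-- Normalizing at every step equals normalizing once at the end. The index is `t + 1` because the
start vector itself is not normalized. -/
theorem powerStep_iterate (b : Cl n) (x : Vec n) (t : ℕ) :
    (powerStep b)^[t + 1] x = ‖((contr b * contr b : Module.End ℝ (Vec n)) ^ (t + 1)) x‖⁻¹ •
      ((contr b * contr b : Module.End ℝ (Vec n)) ^ (t + 1)) x := by
  induction t with
  | zero => simp [powerStep]
  | succ t ih =>
    rw [Function.iterate_succ_apply', ih, pow_succ' _ (t + 1), Module.End.mul_apply]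
    set z := ((contr b * contr b : Module.End ℝ (Vec n)) ^ (t + 1)) x
    by_cases hz : z = 0
    · simp [hz, powerStep]
    · have hz' : ‖z‖ ≠ 0 := norm_ne_zero_iff.mpr hz
      simp only [powerStep, map_smul, norm_smul, norm_inv, norm_norm, mul_inv, inv_inv, smul_smul,
        Module.End.mul_apply]
      congr 1
      field_simp

/-- `A² / (-σ²)` for the map `A` of the bivector `b` with largest singular value `σ`. -/
noncomputable def scaledSq (b : Cl n) : Module.End ℝ (Vec n) :=
  (-(topSV b ^ 2))⁻¹ • (contr b * contr b)

theorem scaledSq_apply (b : Cl n) (x : Vec n) :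
    scaledSq b x = (-(topSV b ^ 2))⁻¹ • contr b (contr b x) := rfl

theorem scaledSq_isSymmetric {b : Cl n} (hb : b ∈ Cl2 n) : (scaledSq b).IsSymmetric := by
  intro x y
  simp only [scaledSq_apply, real_inner_smul_left, real_inner_smul_right, inner_contr hb]
  simp

theorem inner_scaledSq_nonneg {b : Cl n} (hb : b ∈ Cl2 n) (x : Vec n) :
    0 ≤ inner ℝ (scaledSq b x) x := by
  rw [scaledSq_apply, real_inner_smul_left, inner_contr hb, real_inner_self_eq_norm_sq, inv_neg,
    neg_mul_neg]
  positivity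

theorem norm_scaledSq_le {b : Cl n} (hb : b ∈ Cl2 n) (hb0 : b ≠ 0) (x : Vec n) :
    ‖scaledSq b x‖ ≤ ‖x‖ := by
  have hσ := topSV_pos hb hb0
  have h1 : ‖contr b (contr b x)‖ ≤ topSV b ^ 2 * ‖x‖ :=
    (norm_contr_le b _).trans (by
      rw [sq, mul_assoc]; exact mul_le_mul_of_nonneg_left (norm_contr_le b x) hσ.le)
  rw [scaledSq_apply, norm_smul, norm_inv, norm_neg, Real.norm_eq_abs, abs_of_pos (pow_pos hσ 2),
    inv_mul_le_iff₀ (pow_pos hσ 2)]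
  exact h1

theorem powerStep_iterate_eq_scaledSq {b : Cl n} (hb : b ∈ Cl2 n) (hb0 : b ≠ 0) (x : Vec n)
    (t : ℕ) : (powerStep b)^[t + 1] x = (-1 : ℝ) ^ (t + 1) •
      (‖(scaledSq b ^ (t + 1)) x‖⁻¹ • (scaledSq b ^ (t + 1)) x) := by
  have hσ := topSV_pos hb hb0
  have hS : (contr b * contr b : Module.End ℝ (Vec n)) = (-(topSV b ^ 2)) • scaledSq b := by
    rw [scaledSq, smul_inv_smul₀ (neg_ne_zero.mpr (pow_pos hσ 2).ne')]
  rw [powerStep_iterate, hS, smul_pow, LinearMap.smul_apply, norm_smul, mul_inv, smul_smul,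
    smul_smul, norm_pow, norm_neg, Real.norm_eq_abs, abs_of_pos (pow_pos hσ 2), neg_pow]
  congr 1
  have := (pow_pos (pow_pos hσ 2) (t + 1)).ne'
  field_simp

/-- The limit of the normalized power iteration is the orthogonal projection of the start vector
onto the top singular space; it is characterized by its pairing with functionals. -/
theorem exists_power_limit {b : Cl n} (hb : b ∈ Cl2 n) (hb0 : b ≠ 0) (x : Vec n) :
    ∃ L : Vec n, contr b (contr b L) = -(topSV b ^ 2 • L) ∧
      (∀ f : Vec n →ₗ[ℝ] ℝ, (∀ z, f (contr b (contr b z)) = -(topSV b ^ 2 * f z)) → f L = f x) ∧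
      (L ≠ 0 → PowerConverges b x ∧ (powerProj b x).2 = ‖L‖⁻¹ • L ∧
        IsSimpleProj b (powerProj b x).1 (powerProj b x).2) := by
  have hσ := topSV_pos hb hb0
  have hσ2 : -(topSV b ^ 2) ≠ 0 := neg_ne_zero.mpr (pow_pos hσ 2).ne'
  obtain ⟨L, hL, hfix⟩ := (scaledSq_isSymmetric hb).exists_tendsto_pow (inner_scaledSq_nonneg hb)
    (norm_scaledSq_le hb hb0) x
  have hAA : contr b (contr b L) = -(topSV b ^ 2 • L) := by
    rw [scaledSq_apply, inv_smul_eq_iff₀ hσ2, neg_smul] at hfix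
    exact hfix
  refine ⟨L, hAA, fun f hf => ?_, fun hL0 => ?_⟩
  · have hc : ∀ t : ℕ, f ((scaledSq b ^ t) x) = f x := by
      intro t
      induction t with
      | zero => simp
      | succ t ih =>
        rw [pow_succ', Module.End.mul_apply, scaledSq_apply, map_smul, hf, ih, smul_eq_mul,
          ← neg_mul, inv_mul_cancel_left₀ hσ2]
    have h1 := (LinearMap.continuous_of_finiteDimensional f).tendsto L |>.comp hL
    refine tendsto_nhds_unique h1 ?_
    simp only [Function.comp_def, hc]
    exact tendsto_const_nhds
  · have hN : Tendsto (fun t : ℕ => ‖(scaledSq b ^ t) x‖⁻¹ • (scaledSq b ^ t) x) atTop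
        (𝓝 (‖L‖⁻¹ • L)) := (hL.norm.inv₀ (norm_ne_zero_iff.mpr hL0)).smul hL
    have heven : Tendsto (fun t : ℕ => (powerStep b)^[2 * t] x) atTop (𝓝 (‖L‖⁻¹ • L)) := by
      have h2 : Tendsto (fun t : ℕ => 2 * t) atTop atTop :=
        tendsto_id.const_mul_atTop' (by norm_num)
      refine (hN.comp h2).congr' ?_
      filter_upwards [eventually_ge_atTop 1] with t ht
      obtain ⟨s, hs⟩ : ∃ s, 2 * t = s + 1 := ⟨2 * t - 1, by omega⟩
      have he : Even (s + 1) := ⟨t, by omega⟩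
      simp only [Function.comp_apply, hs]
      rw [powerStep_iterate_eq_scaledSq hb hb0, he.neg_one_pow, one_smul]
    have hproj : (powerProj b x).2 = ‖L‖⁻¹ • L := heven.limUnder_eq
    have hw1 : ‖‖L‖⁻¹ • L‖ = 1 := by
      rw [norm_smul, norm_inv, norm_norm, inv_mul_cancel₀ (norm_ne_zero_iff.mpr hL0)]
    have hwAA : contr b (contr b (‖L‖⁻¹ • L)) = -(topSV b ^ 2 • (‖L‖⁻¹ • L)) := by
      rw [map_smul, map_smul, hAA, smul_neg, smul_comm]
    refine ⟨⟨by rwa [hproj], ?_⟩, hproj, Or.inr ⟨topSV b, _,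
      isTopSingular_of_contr_contr hb hσ (norm_contr_le b) (hproj ▸ hw1) (hproj ▸ hwAA), ?_⟩⟩
    -- Because of the alternating sign, `x_{t+1} + x_t` is, up to sign, a difference of consecutive
    -- terms of a convergent sequence.
    · have hd : Tendsto (fun t : ℕ => ‖‖(scaledSq b ^ (t + 1)) x‖⁻¹ • (scaledSq b ^ (t + 1)) x -
          ‖(scaledSq b ^ t) x‖⁻¹ • (scaledSq b ^ t) x‖) atTop (𝓝 0) := by
        have := ((hN.comp (tendsto_add_atTop_nat 1)).sub hN).norm
        simpa using this
      refine hd.congr' ?_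
      filter_upwards [eventually_ge_atTop 1] with t ht
      obtain ⟨s, rfl⟩ : ∃ s, t = s + 1 := ⟨t - 1, by omega⟩
      rw [powerStep_iterate_eq_scaledSq hb hb0, powerStep_iterate_eq_scaledSq hb hb0,
        pow_succ (-1 : ℝ) (s + 1), mul_smul, ← smul_add, norm_smul, norm_pow, norm_neg, norm_one, one_pow,
        one_mul, ← norm_neg]
      congr 1
      module
    · have : topSV b • wedge (vec ((topSV b)⁻¹ • contr b (powerProj b x).2))
          (vec (powerProj b x).2) = wedge (vec (contr b (powerProj b x).2))
            (vec (powerProj b x).2) := by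
        rw [wedge_vec_smul_left, smul_inv_smul₀ hσ.ne']
      rw [this]
      rfl

theorem IsTopSingular.inner_contr_contr {b : Cl n} (hb : b ∈ Cl2 n) {σ : ℝ} {u y : Vec n}
    (h : IsTopSingular b σ u y) (z : Vec n) :
    inner ℝ y (contr b (contr b z)) = -(topSV b ^ 2 * inner ℝ y z) := by
  have h1 := inner_contr hb y (contr b z)
  have h2 := inner_contr hb u z
  rw [h.map_right, real_inner_smul_left] at h1
  rw [h.contr_left hb, inner_neg_left, real_inner_smul_left] at h2
  rw [← h.eq_topSV]
  linear_combination h1 - σ * h2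

theorem power_limit_ne_zero {b : Cl n} (hb : b ∈ Cl2 n) (hb0 : b ≠ 0) {x L : Vec n}
    (hx : GoodStart b x)
    (hL : ∀ f : Vec n →ₗ[ℝ] ℝ, (∀ z, f (contr b (contr b z)) = -(topSV b ^ 2 * f z)) →
      f L = f x) : L ≠ 0 := by
  obtain ⟨σ, u, y, ht, hy⟩ := hx hb0
  have h1 := hL (innerₗ (Vec n) y) (fun z => ht.inner_contr_contr hb z)
  rintro rfl
  simp only [map_zero, innerₗ_apply_apply] at h1
  exact hy h1.symm

theorem powerConverges_and_isSimpleProj {b : Cl n} (hb : b ∈ Cl2 n) {x : Vec n}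
    (hx : GoodStart b x) :
    PowerConverges b x ∧ IsSimpleProj b (powerProj b x).1 (powerProj b x).2 := by
  by_cases hb0 : b = 0
  · subst hb0
    -- By the convention `0 / 0 = 0`, every iterate after the start vanishes.
    have h0 : ∀ t : ℕ, (powerStep (0 : Cl n))^[t + 1] x = 0 := by
      intro t
      rw [Function.iterate_succ_apply']
      simp [powerStep, contr_zero]
    have heven : Tendsto (fun t : ℕ => (powerStep (0 : Cl n))^[2 * t] x) atTop (𝓝 0) := by
      refine tendsto_const_nhds.congr' ?_
      filter_upwards [eventually_ge_atTop 1] with t ht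
      obtain ⟨s, hs⟩ : ∃ s, 2 * t = s + 1 := ⟨2 * t - 1, by omega⟩
      rw [hs, h0]
    have hproj : (powerProj (0 : Cl n) x).2 = 0 := heven.limUnder_eq
    refine ⟨⟨by rwa [hproj], tendsto_const_nhds.congr' ?_⟩, Or.inl ⟨rfl, ?_⟩⟩
    · filter_upwards [eventually_ge_atTop 1] with t ht
      obtain ⟨s, rfl⟩ : ∃ s, t = s + 1 := ⟨t - 1, by omega⟩
      simp [h0]
    · simp [powerProj, contr_zero, wedge]
  · obtain ⟨L, -, hf, hL⟩ := exists_power_limit hb hb0 x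
    obtain ⟨h1, -, h3⟩ := hL (power_limit_ne_zero hb hb0 hx hf)
    exact ⟨h1, h3⟩

theorem alongRun_powerProj {m : ℕ} : ∀ {b : Cl n} {v : Fin m → Vec n}, b ∈ Cl2 n →
    AlongRun powerProj GoodStart m b v →
    AlongRun powerProj
      (fun r x => PowerConverges r x ∧ IsSimpleProj r (powerProj r x).1 (powerProj r x).2) m b v := by
  induction m with
  | zero => exact fun _ _ => trivial
  | succ m ih =>
    intro b v hb h
    have h1 := powerConverges_and_isSimpleProj hb h.1
    exact ⟨h1, ih (Submodule.sub_mem _ hb h1.2.mem_Cl2) h.2⟩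

theorem AlongRun.mono {proj : Cl n → Vec n → Cl n × Vec n} {P Q : Cl n → Vec n → Prop}
    (hPQ : ∀ r x, P r x → Q r x) {m : ℕ} : ∀ {b : Cl n} {v : Fin m → Vec n},
    AlongRun proj P m b v → AlongRun proj Q m b v := by
  induction m with
  | zero => exact fun _ => trivial
  | succ m ih => exact fun h => ⟨hPQ _ _ h.1, ih h.2⟩

end PowerIteration

/-! ## Differentiability of simple roots, and spectral projections from adjugates -/

section Adjugate

variable {ι K : Type*} [Fintype ι] [DecidableEq ι] [Field K]

open Polynomial in
-- Over polynomials, `(X - M) u = (X - μ) u`; applying the adjugate gives `(X - μ) adj(X - M) u =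
-- p(X) u`. Differentiate at `X = μ`.
theorem adjugate_mulVec_of_eigen {M : Matrix ι ι K} {μ : K} {u : ι → K}
    (hu : M.mulVec u = μ • u) :
    (Matrix.scalar ι μ - M).adjugate.mulVec u = (derivative M.charpoly).eval μ • u := by
  have hmap : (evalRingHom μ).mapMatrix M.charmatrix = Matrix.scalar ι μ - M := by
    ext i j
    by_cases hij : i = j
    · subst hij; simp
    · simp [hij]
  have h1 : M.charmatrix.mulVec (fun j => C (u j)) = fun i => (X - C μ) * C (u i) := by
    ext1 i
    have := congrFun hu i
    simp only [Matrix.mulVec, dotProduct, Pi.smul_apply, smul_eq_mul] at this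
    simp only [Matrix.charmatrix, Matrix.sub_mulVec, Pi.sub_apply, Matrix.scalar_apply,
      Matrix.mulVec_diagonal, sub_mul]
    congr 1
    simp only [Matrix.mulVec, dotProduct, RingHom.mapMatrix_apply, Matrix.map_apply, ← C_mul,
      ← this, map_sum]
  have h2 : ∀ i, (X - C μ) * (M.charmatrix.adjugate.mulVec fun j => C (u j)) i =
      M.charpoly * C (u i) := by
    intro i
    have h3 : M.charmatrix.adjugate.mulVec (M.charmatrix.mulVec fun j => C (u j)) =
        M.charpoly • fun j => C (u j) := by
      rw [Matrix.mulVec_mulVec, Matrix.adjugate_mul, Matrix.smul_mulVec, Matrix.one_mulVec]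
      rfl
    rw [h1] at h3
    have h4 := congrFun h3 i
    simp only [Pi.smul_apply, smul_eq_mul] at h4
    rw [← h4]
    simp only [Matrix.mulVec, dotProduct, Finset.mul_sum]
    exact Finset.sum_congr rfl fun j _ => by ring
  ext i
  have h5 := congrArg (fun q => (derivative q).eval μ) (h2 i)
  simp only [derivative_mul, derivative_sub, derivative_X, derivative_C, eval_add, eval_mul,
    eval_sub, eval_X, eval_C, sub_self, zero_mul, add_zero, mul_zero, sub_zero, one_mul] at h5
  rw [Pi.smul_apply, smul_eq_mul, ← h5]
  simp only [Matrix.mulVec, dotProduct, eval_finsetSum, eval_mul, eval_C]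
  refine Finset.sum_congr rfl fun j _ => ?_
  rw [← hmap, ← RingHom.map_adjugate]
  rfl

/-- `adj(μ - M) (μ - M) = 0`. In particular the adjugate kills eigenvectors of every other
eigenvalue. -/
theorem adjugate_mulVec_mulVec {M : Matrix ι ι K} {μ : K}
    (hμ : (Matrix.scalar ι μ - M).det = 0) (z : ι → K) :
    (Matrix.scalar ι μ - M).adjugate.mulVec (M.mulVec z) =
      μ • (Matrix.scalar ι μ - M).adjugate.mulVec z := by
  have h1 : (Matrix.scalar ι μ - M).adjugate.mulVec ((Matrix.scalar ι μ - M).mulVec z) = 0 := by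
    rw [Matrix.mulVec_mulVec, Matrix.adjugate_mul, hμ, zero_smul, Matrix.zero_mulVec]
  have h2 : (Matrix.scalar ι μ - M).mulVec z = μ • z - M.mulVec z := by
    rw [Matrix.sub_mulVec]
    congr 1
    ext i
    simp [Matrix.mulVec_diagonal]
  rw [h2, Matrix.mulVec_sub, Matrix.mulVec_smul, sub_eq_zero] at h1
  exact h1.symm

end Adjugate

/-! ### Differentiable dependence of a simple root -/

section SimpleRoot

/-- The map `(e, z) ↦ (e, F (e, z))` has invertible derivative because its partial derivative in `z`
is multiplication by `c ≠ 0`. Continuity of `s` keeps `(g q, s q)` where the local inverse applies,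
so `s q` is the second component of that inverse at `(g q, 0)`. -/
theorem differentiableAt_simple_root {Y E : Type*} [NormedAddCommGroup Y] [NormedSpace ℝ Y]
    [NormedAddCommGroup E] [NormedSpace ℝ E] [CompleteSpace E] {F : E × ℂ → ℂ} {g : Y → E}
    {s : Y → ℂ} {p : Y} {c : ℂ} (hF : ContDiffAt ℝ 1 F (g p, s p))
    (hc : HasDerivAt (fun z => F (g p, z)) c (s p)) (hc0 : c ≠ 0) (hg : DifferentiableAt ℝ g p)
    (hs : ContinuousAt s p) (hroot : ∀ q, F (g q, s q) = 0) : DifferentiableAt ℝ s p := by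
  set F' := fderiv ℝ F (g p, s p)
  have hF' : HasStrictFDerivAt F F' (g p, s p) := hF.hasStrictFDerivAt one_ne_zero
  have hpart : ∀ z : ℂ, F' (0, z) = c * z := by
    intro z
    have h1 : HasFDerivAt (fun z : ℂ => F (g p, z))
        (F'.comp (ContinuousLinearMap.inr ℝ E ℂ)) (s p) :=
      hF'.hasFDerivAt.comp (s p) (hasFDerivAt_prodMk_right (g p) (s p))
    have h2 := hc.hasFDerivAt.restrictScalars ℝ
    have := congrArg (fun f => f z) (h1.unique h2)
    simpa [mul_comm] using this
  have hsplit : ∀ e z, F' (e, z) = F' (e, 0) + c * z := by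
    intro e z
    rw [← hpart, ← map_add]
    simp
  let mulInv : ℂ →L[ℝ] ℂ := c⁻¹ • ContinuousLinearMap.id ℝ ℂ
  -- The inverse is `(e, w) ↦ (e, c⁻¹ (w - F' (e, 0)))`.
  let A : (E × ℂ) ≃L[ℝ] (E × ℂ) := ContinuousLinearEquiv.equivOfInverse
    ((ContinuousLinearMap.fst ℝ E ℂ).prod F')
    ((ContinuousLinearMap.fst ℝ E ℂ).prod (mulInv.comp ((ContinuousLinearMap.snd ℝ E ℂ) -
      (F'.comp (ContinuousLinearMap.inl ℝ E ℂ)).comp (ContinuousLinearMap.fst ℝ E ℂ))))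
    (fun ⟨e, z⟩ => by
      ext1
      · simp
      · simp [mulInv, hsplit e z]
        field_simp
        ring)
    (fun ⟨e, z⟩ => by
      ext1
      · simp
      · simp only [ContinuousLinearMap.prod_apply, ContinuousLinearMap.coe_fst']
        rw [hsplit]
        simp [mulInv]
        field_simp
        ring)
  let H : E × ℂ → E × ℂ := fun x => (x.1, F x)
  have hH : HasStrictFDerivAt H (A : (E × ℂ) →L[ℝ] (E × ℂ)) (g p, s p) :=
    hasStrictFDerivAt_fst.prodMk hF'
  have hcont : ContinuousAt (fun q => (g q, s q)) p := hg.continuousAt.prodMk hs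
  have hev := hcont.eventually hH.eventually_left_inverse
  have hH0 : ∀ q, H (g q, s q) = (g q, 0) := fun q => Prod.ext rfl (hroot q)
  have hloc : DifferentiableAt ℝ (HasStrictFDerivAt.localInverse H A (g p, s p) hH) (g p, 0) := by
    have := hH.to_localInverse.hasFDerivAt.differentiableAt
    rwa [hH0] at this
  have hcomp : DifferentiableAt ℝ (fun q => (HasStrictFDerivAt.localInverse H A (g p, s p) hH (g q, 0)).2) p :=
    (DifferentiableAt.comp (g := HasStrictFDerivAt.localInverse H A (g p, s p) hH) (f := fun q => (g q, (0 : ℂ))) p hloc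
      (hg.prodMk (differentiableAt_const 0))).snd
  refine hcomp.congr_of_eventuallyEq ?_
  filter_upwards [hev] with q hq
  rw [hH0] at hq
  exact (congrArg Prod.snd hq).symm

variable {Y : Type*} [NormedAddCommGroup Y] [NormedSpace ℝ Y] {n : ℕ}

theorem differentiableAt_det {ι : Type*} [Fintype ι] [DecidableEq ι] {f : Y → Matrix ι ι ℂ}
    {p : Y} (hf : ∀ i j, DifferentiableAt ℝ (fun q => f q i j) p) :
    DifferentiableAt ℝ (fun q => (f q).det) p := by
  simp only [Matrix.det_apply]
  exact DifferentiableAt.fun_sum fun τ _ => DifferentiableAt.const_smul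
    (HasFDerivAt.finsetProd fun i _ => (hf (τ i) i).hasFDerivAt).differentiableAt _

theorem differentiableAt_adjugate {ι : Type*} [Fintype ι] [DecidableEq ι] {f : Y → Matrix ι ι ℂ}
    {p : Y} (hf : ∀ i j, DifferentiableAt ℝ (fun q => f q i j) p) (i j : ι) :
    DifferentiableAt ℝ (fun q => (f q).adjugate i j) p := by
  simp only [Matrix.adjugate_apply]
  refine differentiableAt_det fun k l => ?_
  by_cases hk : k = j
  · subst hk; simp
  · simpa [Matrix.updateRow_ne hk] using hf k l

/-- The value at `s` of the characteristic polynomial of `M`, as a function of `(M, s)`. -/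
noncomputable def charDet (x : (Fin n → Fin n → ℂ) × ℂ) : ℂ :=
  (Matrix.scalar (Fin n) x.2 - Matrix.of x.1).det

theorem contDiff_charDet : ContDiff ℝ 2 (charDet (n := n)) := by
  unfold charDet
  simp only [Matrix.det_apply]
  refine ContDiff.sum fun τ _ => ContDiff.const_smul _ (contDiff_prod fun i _ => ?_)
  simp only [Matrix.sub_apply, Matrix.scalar_apply, Matrix.of_apply, Matrix.diagonal_apply]
  refine ContDiff.sub ?_ (by fun_prop)
  split_ifs
  · exact contDiff_snd
  · exact contDiff_const

theorem hasDerivAt_charDet (M : Fin n → Fin n → ℂ) (s : ℂ) :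
    HasDerivAt (fun z => charDet (M, z))
      ((Polynomial.derivative (Matrix.of M).charpoly).eval s) s := by
  have : (fun z => charDet (M, z)) = fun z => (Matrix.of M).charpoly.eval z := by
    ext z; rw [Matrix.eval_charpoly]; rfl
  rw [this]
  exact Polynomial.hasDerivAt _ _

/-- As a partial derivative of the smooth `charDet`, `p'(s)` is visibly differentiable jointly in
the matrix and `s`. -/
theorem eval_derivative_charpoly_eq (M : Fin n → Fin n → ℂ) (s : ℂ) :
    (Polynomial.derivative (Matrix.of M).charpoly).eval s =
      fderiv ℝ charDet (M, s) ((0, 1) : (Fin n → Fin n → ℂ) × ℂ) := by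
  have h0 : HasFDerivAt charDet (fderiv ℝ charDet (M, s)) (M, s) :=
    (contDiff_charDet.differentiable two_ne_zero _).hasFDerivAt
  have h1 : HasFDerivAt (fun z : ℂ => charDet (M, z))
      ((fderiv ℝ charDet (M, s)).comp (ContinuousLinearMap.inr ℝ (Fin n → Fin n → ℂ) ℂ)) s :=
    h0.comp s (hasFDerivAt_prodMk_right M s)
  have h2 := (hasDerivAt_charDet M s).hasFDerivAt.restrictScalars ℝ
  have := congrArg (fun f => f 1) (h1.unique h2)
  simpa using this.symm

theorem differentiableAt_derivative_charpoly {M : Y → Fin n → Fin n → ℂ} {s : Y → ℂ} {p : Y}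
    (hM : DifferentiableAt ℝ M p) (hs : DifferentiableAt ℝ s p) :
    DifferentiableAt ℝ
      (fun q => (Polynomial.derivative (Matrix.of (M q)).charpoly).eval (s q)) p := by
  simp only [eval_derivative_charpoly_eq]
  have h1 : Differentiable ℝ (fderiv ℝ (charDet (n := n))) :=
    (contDiff_charDet.fderiv_right (m := 1) (by norm_num)).differentiable one_ne_zero
  exact ((h1 (M p, s p)).comp p (hM.prodMk hs)).clm_apply (differentiableAt_const _)

end SimpleRoot

/-! ## Differentiability of the power iteration -/

section Differentiability

variable {n : ℕ}

theorem det_eq_zero_of_topSV (hn : 0 < n) {b : Cl n} (hb : b ∈ Cl2 n) :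
    (Matrix.scalar (Fin n) (Complex.I * topSV b) - cMat b).det = 0 := by
  obtain ⟨σ, u, v, h⟩ := exists_isTopSingular hn hb
  have hs := isSpectralTerm_of_singular h.norm_left h.norm_right h.map_right (h.contr_left hb)
  rw [← h.eq_topSV]
  refine Matrix.exists_mulVec_eq_zero_iff.mp ⟨_, hs.ne_zero_plus, ?_⟩
  rw [Matrix.sub_mulVec, hs.eigen_plus]
  ext i
  simp

/-- The derivative of the characteristic polynomial of `b` at the top eigenvalue. -/
noncomputable def topDeriv (b : Cl n) : ℂ :=
  (Polynomial.derivative (cMat b).charpoly).eval (Complex.I * topSV b)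

/-- The spectral projection onto the top singular space, for a simple top eigenvalue. -/
noncomputable def topProj (b : Cl n) : Vec n →ₗ[ℝ] Vec n where
  -- For real `x` the projections for `iσ` and `-iσ` are complex conjugate, so their sum is twice a
  -- real part.
  toFun x := WithLp.toLp 2 fun i => 2 * (((Matrix.scalar (Fin n) (Complex.I * topSV b) -
    cMat b).adjugate.mulVec (cvec x 0) i) / topDeriv b).re
  map_add' x y := by
    have : cvec (x + y) 0 = cvec x 0 + cvec y 0 := by ext i; simp [cvec]
    ext i
    simp [this, Matrix.mulVec_add, add_div, mul_add]
  map_smul' r x := by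
    have : cvec (r • x) 0 = (r : ℂ) • cvec x 0 := by ext i; simp [cvec]
    ext i
    simp only [this, Matrix.mulVec_smul, Pi.smul_apply, smul_eq_mul, mul_div_assoc,
      Complex.re_ofReal_mul, PiLp.smul_apply, RingHom.id_apply]
    ring

theorem topProj_apply (b : Cl n) (x : Vec n) (i : Fin n) :
    topProj b x i = 2 * (((Matrix.scalar (Fin n) (Complex.I * topSV b) -
      cMat b).adjugate.mulVec (cvec x 0) i) / topDeriv b).re := rfl

theorem topProj_contr_contr (hn : 0 < n) {b : Cl n} (hb : b ∈ Cl2 n) (x : Vec n) (i : Fin n) :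
    topProj b (contr b (contr b x)) i = -(topSV b ^ 2 * topProj b x i) := by
  have h0 := det_eq_zero_of_topSV hn hb
  have h1 : cvec (contr b (contr b x)) 0 = (cMat b).mulVec ((cMat b).mulVec (cvec x 0)) := by
    rw [cMat_mulVec_cvec, cMat_mulVec_cvec, map_zero, map_zero]
  rw [topProj_apply, topProj_apply, h1, adjugate_mulVec_mulVec h0, adjugate_mulVec_mulVec h0]
  simp only [Pi.smul_apply, smul_eq_mul]
  have : ∀ z d : ℂ, Complex.I * topSV b * (Complex.I * topSV b * z) / d =
      ((-(topSV b ^ 2) : ℝ) : ℂ) * (z / d) := by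
    intro z d
    push_cast
    linear_combination (topSV b ^ 2 * (z / d) : ℂ) * Complex.I_sq
  rw [this, Complex.re_ofReal_mul]
  ring

/-- With `y = b L / σ`, `L` is half the sum of the eigenvectors `L - iy` for `iσ` and `L + iy` for
`-iσ`. The adjugate scales the first by `topDeriv b` and kills the second. -/
theorem topProj_of_mem (hn : 0 < n) {b : Cl n} (hb : b ∈ Cl2 n) (hb0 : b ≠ 0)
    (hd : topDeriv b ≠ 0) {L : Vec n} (hL : contr b (contr b L) = -(topSV b ^ 2 • L)) :
    topProj b L = L := by
  have hσ := topSV_pos hb hb0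
  have h0 := det_eq_zero_of_topSV hn hb
  have hσc : (topSV b : ℂ) ≠ 0 := by exact_mod_cast hσ.ne'
  have hinv : contr b ((topSV b)⁻¹ • contr b L) = -(topSV b • L) := by
    rw [map_smul, hL, smul_neg, smul_smul]
    congr 2
    field_simp
  set y := (topSV b)⁻¹ • contr b L with hy
  have hLy : contr b L = topSV b • y := by rw [hy, smul_inv_smul₀ hσ.ne']
  have hp : (cMat b).mulVec (cvec L (-y)) = (Complex.I * topSV b) • cvec L (-y) := by
    rw [cMat_mulVec_cvec, map_neg, hinv, hLy]
    ext i
    simp only [cvec, PiLp.neg_apply, PiLp.smul_apply, smul_eq_mul, Pi.smul_apply]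
    push_cast
    linear_combination (topSV b * y i : ℂ) * Complex.I_sq
  have hm : (cMat b).mulVec (cvec L y) = (-(Complex.I * topSV b)) • cvec L y := by
    rw [cMat_mulVec_cvec, hinv, hLy]
    ext i
    simp only [cvec, PiLp.neg_apply, PiLp.smul_apply, smul_eq_mul, Pi.smul_apply]
    push_cast
    linear_combination (topSV b * y i : ℂ) * Complex.I_sq
  have hap := adjugate_mulVec_of_eigen hp
  have ham := adjugate_mulVec_mulVec h0 (cvec L y)
  rw [hm, Matrix.mulVec_smul, eq_comm, ← sub_eq_zero, ← sub_smul, smul_eq_zero] at ham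
  have ham' := ham.resolve_left (by
    rw [sub_neg_eq_add, ← two_mul]
    exact mul_ne_zero two_ne_zero (mul_ne_zero Complex.I_ne_zero hσc))
  have hsplit : cvec L 0 = (1 / 2 : ℂ) • (cvec L (-y) + cvec L y) := by
    ext i
    simp [cvec]
    ring
  ext i
  rw [topProj_apply, hsplit, Matrix.mulVec_smul, Matrix.mulVec_add, hap, ham', add_zero]
  change 2 * ((1 / 2 : ℂ) * (topDeriv b * cvec L (-y) i) / topDeriv b).re = L i
  have : (1 / 2 : ℂ) * (topDeriv b * cvec L (-y) i) / topDeriv b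
      = ((1 / 2 : ℝ) : ℂ) * cvec L (-y) i := by
    push_cast
    field_simp
  rw [this, Complex.re_ofReal_mul]
  simp [cvec]

theorem powerProj_snd_eq (hn : 0 < n) {b : Cl n} (hb : b ∈ Cl2 n) (hb0 : b ≠ 0)
    (hd : topDeriv b ≠ 0) {x : Vec n} (hx : topProj b x ≠ 0) :
    (powerProj b x).2 = ‖topProj b x‖⁻¹ • topProj b x := by
  obtain ⟨L, hAA, hf, hL⟩ := exists_power_limit hb hb0 x
  -- The coordinates of `topProj b` are eigenfunctionals of `A²` for `-σ²`, so they agree at `x` and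
  -- `L`; and `topProj b` fixes `L`.
  have h1 : topProj b x = L := by
    rw [← topProj_of_mem hn hb hb0 hd hAA]
    ext i
    exact (hf ((EuclideanSpace.proj i : Vec n →L[ℝ] ℝ).toLinearMap ∘ₗ topProj b)
      (fun z => topProj_contr_contr hn hb z i)).symm
  rw [h1] at hx ⊢
  exact (hL hx).2.1

theorem topProj_ne_zero (hn : 0 < n) {b : Cl n} (hb : b ∈ Cl2 n) (hb0 : b ≠ 0)
    (hd : topDeriv b ≠ 0) {x : Vec n} (hx : GoodStart b x) : topProj b x ≠ 0 := by
  obtain ⟨L, hAA, hf, -⟩ := exists_power_limit hb hb0 x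
  have h1 : topProj b x = L := by
    rw [← topProj_of_mem hn hb hb0 hd hAA]
    ext i
    exact (hf ((EuclideanSpace.proj i : Vec n →L[ℝ] ℝ).toLinearMap ∘ₗ topProj b)
      (fun z => topProj_contr_contr hn hb z i)).symm
  rw [h1]
  exact power_limit_ne_zero hb hb0 hx hf

variable {Y : Type*} [NormedAddCommGroup Y] [NormedSpace ℝ Y]

theorem continuousAt_topSV {Y : Type*} [TopologicalSpace Y] {b : Y → Cl n} {p : Y}
    (hB : ∀ i j, ContinuousAt (fun q => skewMat (b q) i j) p) :
    ContinuousAt (fun q => topSV (b q)) p := by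
  let Φ : (Fin n → Fin n → ℝ) →ₗ[ℝ] (Vec n →L[ℝ] Vec n) :=
    LinearMap.toContinuousLinearMap.toLinearMap ∘ₗ
      (Matrix.toEuclideanLin (𝕜 := ℝ) (m := Fin n) (n := Fin n)).toLinearMap ∘ₗ
        (Matrix.ofLinearEquiv ℝ).toLinearMap
  have h1 : ∀ a : Cl n, topSV a = ‖Φ (fun i j => skewMat a i j)‖ := by
    intro a
    unfold topSV
    congr 1
    ext z i
    change contr a z i = (skewMat a).mulVec z i
    rw [skewMat_mulVec]
  simp only [h1]
  have h2 : Continuous Φ := LinearMap.continuous_of_finiteDimensional Φ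
  exact (h2.continuousAt.comp
    (continuousAt_pi.mpr fun i => continuousAt_pi.mpr fun j => hB i j)).norm

theorem differentiableAt_cMat {b : Y → Cl n} {p : Y}
    (hB : ∀ i j, DifferentiableAt ℝ (fun q => skewMat (b q) i j) p) (i j : Fin n) :
    DifferentiableAt ℝ (fun q => cMat (b q) i j) p :=
  Complex.ofRealCLM.differentiableAt.comp p (hB i j)

theorem differentiableAt_topEigenvalue (hn : 0 < n) {b : Y → Cl n} {p : Y}
    (hb : ∀ q, b q ∈ Cl2 n) (hB : ∀ i j, DifferentiableAt ℝ (fun q => skewMat (b q) i j) p)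
    (hd : topDeriv (b p) ≠ 0) :
    DifferentiableAt ℝ (fun q => Complex.I * (topSV (b q) : ℂ)) p := by
  refine differentiableAt_simple_root (F := charDet) (g := fun q i j => cMat (b q) i j)
    (contDiff_charDet.contDiffAt.of_le (by norm_num)) (hasDerivAt_charDet _ _) hd
    (differentiableAt_pi.mpr fun i => differentiableAt_pi.mpr fun j =>
      differentiableAt_cMat hB i j) ?_ (fun q => det_eq_zero_of_topSV hn (hb q))
  exact continuousAt_const.mul (Complex.continuous_ofReal.continuousAt.comp
    (continuousAt_topSV fun i j => (hB i j).continuousAt))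

theorem differentiableAt_topDeriv (hn : 0 < n) {b : Y → Cl n} {p : Y}
    (hb : ∀ q, b q ∈ Cl2 n) (hB : ∀ i j, DifferentiableAt ℝ (fun q => skewMat (b q) i j) p)
    (hd : topDeriv (b p) ≠ 0) : DifferentiableAt ℝ (fun q => topDeriv (b q)) p :=
  differentiableAt_derivative_charpoly (M := fun q i j => cMat (b q) i j)
    (differentiableAt_pi.mpr fun i => differentiableAt_pi.mpr fun j =>
      differentiableAt_cMat hB i j) (differentiableAt_topEigenvalue hn hb hB hd)

theorem differentiableAt_topProj (hn : 0 < n) {b : Y → Cl n} {x : Y → Vec n} {p : Y}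
    (hb : ∀ q, b q ∈ Cl2 n) (hB : ∀ i j, DifferentiableAt ℝ (fun q => skewMat (b q) i j) p)
    (hx : DifferentiableAt ℝ x p) (hd : topDeriv (b p) ≠ 0) :
    DifferentiableAt ℝ (fun q => topProj (b q) (x q)) p := by
  rw [differentiableAt_piLp]
  intro i
  simp only [topProj_apply, div_eq_mul_inv]
  refine (Complex.reCLM.differentiableAt.comp p (DifferentiableAt.mul ?_
    ((differentiableAt_topDeriv hn hb hB hd).inv hd))).const_mul 2
  simp only [Matrix.mulVec, dotProduct]
  refine DifferentiableAt.fun_sum fun j _ => DifferentiableAt.mul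
    (differentiableAt_adjugate (fun k l => ?_) i j) ?_
  · simp only [Matrix.sub_apply, Matrix.scalar_apply, Matrix.diagonal_apply]
    refine DifferentiableAt.sub ?_ (differentiableAt_cMat hB k l)
    split_ifs
    · exact differentiableAt_topEigenvalue hn hb hB hd
    · exact differentiableAt_const _
  · have h1 : DifferentiableAt ℝ (fun q => ((x q j : ℝ) : ℂ)) p :=
      Complex.ofRealCLM.differentiableAt.comp p ((differentiableAt_piLp 2).mp hx j)
    simpa [cvec] using h1

theorem differentiableAt_powerProj_snd (hn : 0 < n) {b : Y → Cl n} {x : Y → Vec n} {p : Y}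
    (hb : ∀ q, b q ∈ Cl2 n) (hB : ∀ i j, DifferentiableAt ℝ (fun q => skewMat (b q) i j) p)
    (hx : DifferentiableAt ℝ x p) (hb0 : b p ≠ 0) (hd : topDeriv (b p) ≠ 0)
    (hgood : GoodStart (b p) (x p)) : DifferentiableAt ℝ (fun q => (powerProj (b q) (x q)).2) p := by
  have hT := differentiableAt_topProj hn hb hB hx hd
  have hT0 := topProj_ne_zero hn (hb p) hb0 hd hgood
  have hdiff : DifferentiableAt ℝ
      (fun q => ‖topProj (b q) (x q)‖⁻¹ • topProj (b q) (x q)) p :=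
    ((hT.norm ℝ hT0).inv (norm_ne_zero_iff.mpr hT0)).smul hT
  -- The closed formula holds near `p`: the top singular value, `topDeriv` and the projection stay
  -- nonzero by continuity.
  refine hdiff.congr_of_eventuallyEq ?_
  have hσ := (continuousAt_topSV fun i j => (hB i j).continuousAt).eventually_ne
    (topSV_pos (hb p) hb0).ne'
  have hD := (differentiableAt_topDeriv hn hb hB hd).continuousAt
  filter_upwards [hσ, hD.eventually_ne hd,
    hT.continuousAt.eventually_ne hT0] with q h1 h2 h3
  refine powerProj_snd_eq hn (hb q) (fun h => h1 ?_) h2 h3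
  simp [h, topSV, contr_zero]

theorem differentiableAt_skewMat_powerProj {b : Y → Cl n} {x : Y → Vec n} {p : Y}
    (hB : ∀ i j, DifferentiableAt ℝ (fun q => skewMat (b q) i j) p)
    (hw : DifferentiableAt ℝ (fun q => (powerProj (b q) (x q)).2) p) (i j : Fin n) :
    DifferentiableAt ℝ (fun q => skewMat (powerProj (b q) (x q)).1 i j) p := by
  have hwi : ∀ k, DifferentiableAt ℝ (fun q => (powerProj (b q) (x q)).2 k) p :=
    fun k => (differentiableAt_piLp 2).mp hw k
  have hbw : ∀ k, DifferentiableAt ℝ (fun q => contr (b q) (powerProj (b q) (x q)).2 k) p := by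
    intro k
    simp only [← skewMat_mulVec, Matrix.mulVec, dotProduct]
    exact DifferentiableAt.fun_sum fun l _ => (hB k l).mul (hwi l)
  have h1 : ∀ q, skewMat (powerProj (b q) (x q)).1 i j =
      contr (b q) (powerProj (b q) (x q)).2 i * (powerProj (b q) (x q)).2 j -
      contr (b q) (powerProj (b q) (x q)).2 j * (powerProj (b q) (x q)).2 i :=
    fun q => skewMat_wedge _ _ i j
  simp only [h1]
  exact ((hbw i).mul (hwi j)).sub ((hbw j).mul (hwi i))

/-! ### Nondegenerate bivectors -/

theorem exists_eq_cvec (z : Fin n → ℂ) : ∃ x y : Vec n, z = cvec x y :=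
  ⟨WithLp.toLp 2 fun i => (z i).re, WithLp.toLp 2 fun i => (z i).im, by
    ext i
    simp [cvec, mul_comm Complex.I, Complex.re_add_im]⟩

theorem cvec_eq_zero {x y : Vec n} : cvec x y = 0 ↔ x = 0 ∧ y = 0 := by
  constructor
  · intro h
    have h1 : ∀ i, x i = 0 ∧ y i = 0 := by
      intro i
      have := congrFun h i
      exact ⟨by simpa [cvec] using congrArg Complex.re this,
        by simpa [cvec] using congrArg Complex.im this⟩
    exact ⟨by ext i; exact (h1 i).1, by ext i; exact (h1 i).2⟩
  · rintro ⟨rfl, rfl⟩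
    ext i
    simp [cvec]

/-- For an eigenvector `x + iy`, `b x = -σ y` and `b y = σ x`; adding the two norm bounds gives `σ
(‖x‖ + ‖y‖) ≤ topSV b (‖x‖ + ‖y‖)`. -/
theorem le_topSV_of_root {b : Cl n} {σ : ℝ} (hσ : 0 ≤ σ)
    (h : (cMat b).charpoly.eval (Complex.I * σ) = 0) : σ ≤ topSV b := by
  rw [Matrix.eval_charpoly] at h
  obtain ⟨z, hz0, hz⟩ := Matrix.exists_mulVec_eq_zero_iff.mpr h
  obtain ⟨x, y, rfl⟩ := exists_eq_cvec z
  rw [Matrix.sub_mulVec, cMat_mulVec_cvec] at hz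
  have h1 : ∀ i, contr b x i = -(σ * y i) ∧ contr b y i = σ * x i := by
    intro i
    have := congrFun hz i
    simp only [Pi.sub_apply, Matrix.scalar_apply, Matrix.mulVec_diagonal, cvec,
      Pi.zero_apply] at this
    have hre := congrArg Complex.re this
    have him := congrArg Complex.im this
    simp at hre him
    constructor <;> linarith
  have hx : contr b x = -(σ • y) := by ext i; simpa using (h1 i).1
  have hy : contr b y = σ • x := by ext i; simpa using (h1 i).2
  have e1 := norm_contr_le b x
  have e2 := norm_contr_le b y
  rw [hx, norm_neg, norm_smul, Real.norm_eq_abs, abs_of_nonneg hσ] at e1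
  rw [hy, norm_smul, Real.norm_eq_abs, abs_of_nonneg hσ] at e2
  have hpos : 0 < ‖x‖ + ‖y‖ := by
    rcases eq_or_ne x 0 with hx0 | hx0
    · have : y ≠ 0 := fun hy0 => hz0 (cvec_eq_zero.mpr ⟨hx0, hy0⟩)
      have := norm_pos_iff.mpr this
      have := norm_nonneg x
      linarith
    · have := norm_pos_iff.mpr hx0
      have := norm_nonneg y
      linarith
  by_contra hlt
  rw [not_le] at hlt
  nlinarith

open Polynomial in
theorem charpoly_cMat_of_charpoly_skewMat {b : Cl n} {k a : ℕ} {σ : Fin k → ℝ}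
    (h : (skewMat b).charpoly = X ^ a * ∏ j, (X ^ 2 + C (σ j ^ 2))) :
    (cMat b).charpoly = X ^ a * ∏ j, (X ^ 2 + C ((σ j : ℂ) ^ 2)) := by
  have h2 := Matrix.charpoly_map (skewMat b) Complex.ofRealHom
  have h3 : cMat b = (skewMat b).map Complex.ofRealHom := rfl
  rw [h3, h2, h, Polynomial.map_mul, Polynomial.map_prod, Polynomial.map_pow, map_X]
  simp

open Polynomial in
theorem topSV_eq_of_charpoly (hn : 0 < n) {b : Cl n} (hb : b ∈ Cl2 n) {k a : ℕ}
    {σ : Fin (k + 1) → ℝ} (hanti : StrictAnti σ) (hpos : 0 < σ 0)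
    (hnonneg : ∀ j, 0 ≤ σ j)
    (h : (skewMat b).charpoly = X ^ a * ∏ j, (X ^ 2 + C (σ j ^ 2))) : topSV b = σ 0 := by
  have hc := charpoly_cMat_of_charpoly_skewMat h
  have hle : σ 0 ≤ topSV b := by
    refine le_topSV_of_root hpos.le ?_
    rw [hc, eval_mul, eval_prod, Fin.prod_univ_succ]
    simp [mul_pow]
  refine le_antisymm ?_ hle
  have hroot := det_eq_zero_of_topSV hn hb
  rw [← Matrix.eval_charpoly, hc, eval_mul, eval_prod, mul_eq_zero] at hroot
  have ht : 0 < topSV b := hpos.trans_le hle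
  rcases hroot with h1 | h1
  · have h2 : (Complex.I * (topSV b : ℂ)) ≠ 0 :=
      mul_ne_zero Complex.I_ne_zero (by exact_mod_cast ht.ne')
    simp only [eval_pow, eval_X] at h1
    exact absurd h1 (pow_ne_zero _ h2)
  · obtain ⟨j, -, hj⟩ := Finset.prod_eq_zero_iff.mp h1
    simp only [eval_add, eval_pow, eval_X, eval_C, mul_pow, Complex.I_sq] at hj
    have h3 : topSV b ^ 2 = σ j ^ 2 := by
      have : (((σ j) ^ 2 - topSV b ^ 2 : ℝ) : ℂ) = 0 := by
        push_cast; linear_combination hj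
      have := Complex.ofReal_eq_zero.mp this
      linarith
    rw [sq_eq_sq₀ ht.le (hnonneg j)] at h3
    rw [h3]
    exact hanti.antitone (Fin.zero_le j)

open Polynomial in
theorem topDeriv_ne_zero_of_charpoly {b : Cl n} {k a : ℕ} {σ : Fin (k + 1) → ℝ}
    (hanti : StrictAnti σ) (hpos : 0 < σ 0) (hnonneg : ∀ j, 0 ≤ σ j) (htop : topSV b = σ 0)
    (h : (skewMat b).charpoly = X ^ a * ∏ j, (X ^ 2 + C (σ j ^ 2))) : topDeriv b ≠ 0 := by
  have hc := charpoly_cMat_of_charpoly_skewMat h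
  have hfac : (cMat b).charpoly = (X - C (Complex.I * σ 0)) * ((X + C (Complex.I * σ 0)) *
      (X ^ a * ∏ j : Fin k, (X ^ 2 + C ((σ j.succ : ℂ) ^ 2)))) := by
    have h1 : C (Complex.I * (σ 0 : ℂ)) ^ 2 = -C ((σ 0 : ℂ) ^ 2) := by
      rw [← C_pow, ← C_neg, mul_pow, Complex.I_sq]; simp
    rw [hc, Fin.prod_univ_succ]
    linear_combination (X ^ a * ∏ j : Fin k, (X ^ 2 + C ((σ j.succ : ℂ) ^ 2))) * h1
  have h0 : (σ 0 : ℂ) ≠ 0 := by exact_mod_cast hpos.ne'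
  have hμ : Complex.I * (σ 0 : ℂ) ≠ 0 := mul_ne_zero Complex.I_ne_zero h0
  rw [topDeriv, htop, hfac, derivative_mul, eval_add, eval_mul, eval_mul]
  simp only [derivative_sub, derivative_X, derivative_C, sub_zero, eval_one, one_mul, eval_sub,
    eval_X, eval_C, sub_self, zero_mul, add_zero, eval_mul, eval_add, eval_pow, eval_prod]
  refine mul_ne_zero ?_ (mul_ne_zero (pow_ne_zero _ hμ) (Finset.prod_ne_zero_iff.mpr ?_))
  · rw [← two_mul]
    exact mul_ne_zero two_ne_zero hμ
  · intro j _ hj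
    have h2 : (((σ j.succ) ^ 2 - σ 0 ^ 2 : ℝ) : ℂ) = 0 := by
      push_cast
      linear_combination hj - (σ 0 : ℂ) ^ 2 * Complex.I_sq
    have h3 : σ j.succ ^ 2 = σ 0 ^ 2 := by
      have := Complex.ofReal_eq_zero.mp h2
      linarith
    rw [sq_eq_sq₀ (hnonneg _) (hnonneg _)] at h3
    exact (hanti (Fin.succ_pos j)).ne h3

open Polynomial in
theorem Nondegenerate.residual {m : ℕ} (hm : 2 * (m + 2) ≤ n) {b s : Cl n} {w : Vec n}
    (hb : b ∈ Cl2 n) (hs : IsSimpleProj b s w) (h : Nondegenerate (m + 1) b) :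
    b ≠ 0 ∧ topDeriv b ≠ 0 ∧ Nondegenerate m (b - s) := by
  obtain ⟨τ, hanti, hnonneg, hchar⟩ := h
  -- At least two values are present whenever the subroutine is called, so the top one is positive
  -- even if the last is zero.
  have hpos : 0 < τ 0 := (hnonneg 1).trans_lt (hanti Fin.zero_lt_one)
  have htop := topSV_eq_of_charpoly (by omega) hb hanti hpos hnonneg hchar
  refine ⟨?_, topDeriv_ne_zero_of_charpoly hanti hpos hnonneg htop hchar, fun j => τ j.succ,
    fun i j hij => hanti (Fin.succ_lt_succ_iff.mpr hij), fun j => hnonneg _, ?_⟩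
  · rintro rfl
    rw [topSV, contr_zero] at htop
    simp at htop
    linarith
  · obtain ⟨σ, u, v, hd, rfl, -⟩ := hs.exists_isDominant hb (W := ⊤)
      (by rw [finrank_top, finrank_euclideanSpace_fin]; omega) (fun _ => Submodule.mem_top)
    have hσ : σ = τ 0 := by
      rw [← htop]
      refine le_antisymm ?_ (ContinuousLinearMap.opNorm_le_bound _ hd.nonneg hd.top)
      have := norm_contr_le b v
      rwa [hd.map_right, norm_smul, hd.norm_left, hd.norm_right, mul_one, mul_one,
        Real.norm_eq_abs, abs_of_nonneg hd.nonneg] at this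
    have hmul : skewMat (b - σ • wedge (vec u) (vec v)) * skewMat (σ • wedge (vec u) (vec v))
        = 0 := by
      ext i j
      rw [skewMat_mul, contr_smul, LinearMap.smul_apply, contr_wedge, map_smul, map_sub, map_smul,
        map_smul, hd.residual_left, hd.residual_right]
      simp
    -- Cancelling the factor of the removed plane leaves the product over the remaining `τ j`.
    have key := charpoly_mul_charpoly_of_mul_eq_zero hmul
    rw [charpoly_skewMat_smul_wedge (by omega) _ hd.norm_left hd.norm_right hd.ortho,
      ← skewMat_add, sub_add_cancel, hchar, Fin.prod_univ_succ, Fintype.card_fin, hσ] at key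
    have hne : (X : ℝ[X]) ^ (n - 2) * (X ^ 2 + C (τ 0 ^ 2)) ≠ 0 :=
      mul_ne_zero (pow_ne_zero _ X_ne_zero) (by
        intro h0
        have := congrArg (eval 1) h0
        simp at this
        nlinarith [sq_nonneg (τ 0)])
    rw [hσ]
    refine mul_right_cancel₀ hne (key.trans ?_)
    have h1 : (X : ℝ[X]) ^ n * X ^ (n - 2 * (m + 1 + 1)) = X ^ (n - 2) * X ^ (n - 2 * (m + 1)) := by
      rw [← pow_add, ← pow_add]; congr 1; omega
    linear_combination (∏ j : Fin (m + 1), (X ^ 2 + C (τ j.succ ^ 2))) *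
      (X ^ 2 + C (τ 0 ^ 2)) * h1

/-- All data depend on a parameter in an arbitrary normed space `Y`, so the residual is again such a
family and the induction closes. Bivectors are tracked through their matrix entries, which determine
them. -/
theorem differentiableAt_invDecomp (m : ℕ) : ∀ {b : Y → Cl n} {v : Y → Fin m → Vec n} {p : Y},
    2 * (m + 1) ≤ n → (∀ q, b q ∈ Cl2 n) →
    (∀ i j, DifferentiableAt ℝ (fun q => skewMat (b q) i j) p) →
    (∀ l, DifferentiableAt ℝ (fun q => v q l) p) → Nondegenerate m (b p) →
    AlongRun powerProj GoodStart m (b p) (v p) →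
    (∀ l i j, DifferentiableAt ℝ
        (fun q => skewMat ((invDecomp powerProj m (b q) (v q)).1 l) i j) p) ∧
      ∀ l, DifferentiableAt ℝ (fun q => (invDecomp powerProj m (b q) (v q)).2 l) p := by
  induction m with
  | zero => exact fun _ _ hB _ _ _ => ⟨fun _ => hB, fun l => l.elim0⟩
  | succ m ih =>
    intro b v p hm hb hB hv hnd hrun
    have hproj := powerConverges_and_isSimpleProj (hb p) hrun.1
    obtain ⟨hb0, hd, hnd'⟩ := hnd.residual hm (hb p) hproj.2
    have hw := differentiableAt_powerProj_snd (by omega) hb hB (hv 0) hb0 hd hrun.1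
    have hs := differentiableAt_skewMat_powerProj hB hw
    have hrest := ih (b := fun q => b q - (powerProj (b q) (v q 0)).1)
      (v := fun q => Fin.tail (v q)) (p := p) (by omega)
      (fun q => Submodule.sub_mem _ (hb q) (wedge_vec_mem_Cl2 _ _))
      (fun i j => by
        simp only [skewMat_sub, Matrix.sub_apply]
        exact (hB i j).sub (hs i j))
      (fun l => hv l.succ) hnd' hrun.2
    exact ⟨Fin.cases hs hrest.1, Fin.cases hw hrest.2⟩

theorem differentiable_skewMat_bivec (i j : Fin n) :
    Differentiable ℝ fun c : Fin n → Fin n → ℝ => skewMat (bivec c) i j := by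
  have h : ∀ c : Fin n → Fin n → ℝ, skewMat (bivec c) i j = ∑ k, ∑ l ∈ Finset.Ioi k,
      c k l * skewMat (wedge (vec (stdVec k)) (vec (stdVec l))) i j := by
    intro c
    simp [skewMat, bivec, contr_sum, contr_smul]
  simp only [h]
  fun_prop

end Differentiability

/-- Here `m = k - 1`, and `hm` forces `n ≥ 2`. For differentiability, bivectors are parametrized by
coefficients `c` and read off as matrices, with all outputs bundled into one map. -/
theorem mainTheorem2 (n m : ℕ) (hm : m + 1 = n / 2) :
    (∀ b ∈ Cl2 n, ∃ (σ : ℝ) (u v : Vec n), IsTopSingular b σ u v) ∧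
    (∀ (proj : Cl n → Vec n → Cl n × Vec n), ∀ b ∈ Cl2 n, ∀ v : Fin m → Vec n,
      AlongRun proj (fun r x => IsSimpleProj r (proj r x).1 (proj r x).2) m b v →
        IsCorrectOutput b (invDecomp proj m b v).1 (invDecomp proj m b v).2) ∧
    (∀ b ∈ Cl2 n, ∀ v : Fin m → Vec n, AlongRun powerProj GoodStart m b v →
      AlongRun powerProj
        (fun r x => PowerConverges r x ∧ IsSimpleProj r (powerProj r x).1 (powerProj r x).2)
        m b v ∧
      IsCorrectOutput b (invDecomp powerProj m b v).1 (invDecomp powerProj m b v).2) ∧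
    (∀ (c : Fin n → Fin n → ℝ) (v : Fin m → Vec n), Nondegenerate m (bivec c) →
      AlongRun powerProj GoodStart m (bivec c) v →
      DifferentiableAt ℝ
        (fun p : (Fin n → Fin n → ℝ) × (Fin m → Vec n) =>
          ((fun (l : Fin (m + 1)) (i j : Fin n) =>
              skewMat ((invDecomp powerProj m (bivec p.1) p.2).1 l) i j),
            (invDecomp powerProj m (bivec p.1) p.2).2))
        (c, v)) := by
  refine ⟨fun b hb => exists_isTopSingular (by omega) hb,
    fun proj b hb v h => isCorrectOutput_invDecomp hm hb h, fun b hb v h => ?_,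
    fun c v hnd h => ?_⟩
  · have h1 := alongRun_powerProj hb h
    exact ⟨h1, isCorrectOutput_invDecomp hm hb (h1.mono fun _ _ h2 => h2.2)⟩
  · have h1 := differentiableAt_invDecomp (Y := (Fin n → Fin n → ℝ) × (Fin m → Vec n)) m
      (b := fun p => bivec p.1) (v := fun p => p.2) (p := (c, v)) (by omega)
      (fun p => bivec_mem_Cl2 _)
      (fun i j => (differentiable_skewMat_bivec i j _).comp (c, v) differentiableAt_fst)
      (fun l => (differentiableAt_pi.mp differentiableAt_snd) l) hnd h
    exact (differentiableAt_pi.mpr fun l => differentiableAt_pi.mpr fun i =>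
      differentiableAt_pi.mpr fun j => h1.1 l i j).prodMk (differentiableAt_pi.mpr h1.2)
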